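/- Let $\mathfrak g=\mathfrak{sl}_2(\mathbb C)$ and let $SO(2,\mathbb C)=\{k(z)=\mathrm{diag}(z,z^{-1}) : z\in\mathbb C^\times\}$ act on $\mathfrak g$ by conjugation, with isotypic spaces $\mathfrak g_m=\{A\in\mathfrak g : k(z)Ak(z)^{-1}=z^mA \text{ for all } z\in\mathbb C^\times\}$. Let $H\in\mathfrak g_0$, $X\in\mathfrak g_2$, $Y\in\mathfrak g_{-2}$ be a basis of $\mathfrak g$ with $[H,X]=2X$, $[H,Y]=-2Y$, $[X,Y]=H$. Let $\mathfrak g(0)=\mathbb C[x]\otimes_{\mathbb C}\mathfrak g$, a Lie algebra over $\mathbb C[x]$ whose elements are regarded as polynomial functions $F:\mathbb C\to\mathfrak g$. For $n\in\mathbb N_0$ let $$\mathfrak l(n)=\{F\in\mathfrak g(0) : F^{(k)}(0)\in\mathfrak g_0\oplus\mathfrak g_2\ \text{ for all } 0\le k<n\},$$ and put $H_n=1\otimes H$, $X_n=1\otimes X$, $Y_n=x^n\otimes Y$. Let $\mathfrak g(n)$ denote a Lie algebra over $\mathbb C[x]$ with a $\mathbb C[x]$-basis $H',X',Y'$ such that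 $[H',X']=2X'$, $[H',Y']=-2Y'$, $[X',Y']=x^nH'$. All enveloping algebras $\mathcal U(\cdot)$ of Lie algebras over $\mathbb C[x]$ are taken over $\mathbb C[x]$, and $\mathcal Z(\cdot)$ is the center of $\mathcal U(\cdot)$. Let $\Omega_{\mathfrak g}=\frac18H^2+\frac14(XY+YX)\in\mathcal U(\mathfrak g)$ and $\Omega_n=\frac{x^n}{8}H_n^2+\frac14(X_nY_n+Y_nX_n)\in\mathcal U(\mathfrak l(n))$. **Theorem.** Let $n\in\mathbb N_0$. 1. The canonical map $\mathcal U(\mathfrak g(0))\to\mathbb C[x]\otimes_{\mathbb C}\mathcal U(\mathfrak g)$ is an isomorphism, the map $\mathbb C[x]\otimes_{\mathbb C}\mathcal Z(\mathfrak g)\to\mathbb C[x]\otimes_{\mathbb C}\mathcal U(\mathfrak g)$ is injective, and its image is the image of $\mathcal Z(\mathfrak g(0))$; thus $\mathcal Z(\mathfrak g(0))\simeq\mathbb C[x]\otimes_{\mathbb C}\mathcal Z(\mathfrak g)$. 2. The inclusion induces an injection $\mathcal U(\mathfrak l(n))\to\mathcal U(\mathfrak g(0))$. The element $\Omega_{\mathfrak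 g}$ lies in $\mathcal Z(\mathfrak g)$, and under these maps $\Omega_n$ corresponds to $x^n\otimes\Omega_{\mathfrak g}$ and $\mathcal Z(\mathfrak l(n))$ to the $\mathbb C[x]$-subalgebra of $\mathbb C[x]\otimes_{\mathbb C}\mathcal Z(\mathfrak g)$ generated by $x^n\otimes\Omega_{\mathfrak g}$. 3. $\mathcal Z(\mathfrak l(n))$ is the $\mathbb C[x]$-subalgebra of $\mathcal U(\mathfrak l(n))$ generated by $\Omega_n$, and $\Omega_n$ is transcendental over $\mathbb C[x]$; that is, $\mathcal Z(\mathfrak l(n))=\mathbb C[x,\Omega_n]$ is a polynomial algebra. 4. $H_n,X_n,Y_n$ is a $\mathbb C[x]$-basis of $\mathfrak l(n)$ with $[H_n,X_n]=2X_n$, $[H_n,Y_n]=-2Y_n$, $[X_n,Y_n]=x^nH_n$. For every realization of $\mathfrak g(n)$ there is an isomorphism $\mathfrak l(n)\simeq\mathfrak g(n)$ of Lie algebras over $\mathbb C[x]$ taking $H_n,X_n,Y_n$ to $H',X',Y'$, and the center of $\mathcal U(\mathfrak g(n))$ is the polynomial algebra over $\mathbb C[x]$ generated by $\frac{x^n}{8}H'^2+\frac14(X'Y'+Y'X')$.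 -/

import Mathlib

open scoped TensorProduct Polynomial

noncomputable section

namespace Sl2Family

attribute [local instance 100] LieRing.ofAssociativeRing

/-- The complex Lie algebra `𝔰𝔩₂(ℂ)` of traceless two by two matrices. -/
def Sl2 : Type := LieAlgebra.SpecialLinear.sl (Fin 2) ℂ

instance : LieRing Sl2 := inferInstanceAs (LieRing (LieAlgebra.SpecialLinear.sl (Fin 2) ℂ))

instance : LieAlgebra ℂ Sl2 :=
  inferInstanceAs (LieAlgebra ℂ (LieAlgebra.SpecialLinear.sl (Fin 2) ℂ))

/-- The matrix underlying an element of `𝔰𝔩₂(ℂ)`. -/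
def toMat : Sl2 →ₗ[ℂ] Matrix (Fin 2) (Fin 2) ℂ :=
  (LieAlgebra.SpecialLinear.sl (Fin 2) ℂ).toSubmodule.subtype

theorem toMat_injective : Function.Injective toMat := Subtype.val_injective

theorem toMat_lie (A B : Sl2) : toMat ⁅A, B⁆ = toMat A * toMat B - toMat B * toMat A := rfl

theorem toMat_trace (A : Sl2) : toMat A 1 1 = -toMat A 0 0 := by
  have h : (toMat A).trace = 0 := LinearMap.mem_ker.1 A.2
  rw [Matrix.trace_fin_two] at h
  linear_combination h

/-- The element of `𝔰𝔩₂(ℂ)` with matrix `(a, b; c, -a)`. -/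
def ofEntries (a b c : ℂ) : Sl2 :=
  ⟨!![a, b; c, -a], LinearMap.mem_ker.2 (by simp [Matrix.trace_fin_two])⟩

theorem toMat_ofEntries (a b c : ℂ) : toMat (ofEntries a b c) = !![a, b; c, -a] := rfl

/-- The constant family: the Lie algebra `ℂ[x] ⊗ 𝔰𝔩₂(ℂ)` over `ℂ[x]`. -/
abbrev ConstFamily : Type := ℂ[X] ⊗[ℂ] Sl2

/-- The element `k(z) = diag(z, z⁻¹)` of `SO(2, ℂ)`, realized as the diagonal torus. -/
def torus (z : ℂˣ) : Matrix (Fin 2) (Fin 2) ℂ := !![(z : ℂ), 0; 0, ((z⁻¹ : ℂˣ) : ℂ)]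

/-- The `SO(2, ℂ)`-isotypic space `𝔤_m`: all `A` with `k(z) A k(z)⁻¹ = z ^ m A` for every `z`. -/
def isotypic (m : ℤ) : Submodule ℂ Sl2 where
  carrier := {A | ∀ z : ℂˣ, torus z * toMat A * torus z⁻¹ = ((z ^ m : ℂˣ) : ℂ) • toMat A}
  zero_mem' := fun z => by simp
  add_mem' := fun {A B} hA hB z => by
    rw [map_add, mul_add, add_mul, smul_add, hA z, hB z]
  smul_mem' := fun c A hA z => by
    rw [map_smul, mul_smul_comm, smul_mul_assoc, hA z, smul_comm]

/-- `F ↦ F⁽ᵏ⁾(0)`, where `F = ∑ fᵢ ⊗ Aᵢ` is seen as the polynomial function `t ↦ ∑ fᵢ(t) Aᵢ`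
with values in `𝔰𝔩₂(ℂ)`. -/
def derivAtZero (k : ℕ) : ConstFamily →ₗ[ℂ] Sl2 :=
  (TensorProduct.lid ℂ Sl2).toLinearMap ∘ₗ
    LinearMap.rTensor Sl2 (Polynomial.leval (0 : ℂ) ∘ₗ (Polynomial.derivative ^ k))

theorem derivAtZero_tmul (k : ℕ) (f : ℂ[X]) (A : Sl2) :
    derivAtZero k (f ⊗ₜ[ℂ] A) = (Polynomial.derivative^[k] f).eval 0 • A := by
  simp [derivAtZero, Polynomial.leval, Module.End.pow_apply]

theorem derivAtZero_smul (k : ℕ) (p : ℂ[X]) (F : ConstFamily) :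
    derivAtZero k (p • F) = ∑ i ∈ Finset.range (k + 1),
      ((k.choose i : ℂ) * (Polynomial.derivative^[k - i] p).eval 0) • derivAtZero i F := by
  induction F using TensorProduct.induction_on with
  | zero => simp
  | add F G hF hG => rw [smul_add, map_add, hF, hG]; simp [Finset.sum_add_distrib]
  | tmul f A =>
    rw [TensorProduct.smul_tmul', derivAtZero_tmul, smul_eq_mul,
      Polynomial.iterate_derivative_mul, Polynomial.eval_finsetSum, Finset.sum_smul]
    refine Finset.sum_congr rfl fun i _ => ?_
    rw [derivAtZero_tmul, smul_smul]
    simp [mul_assoc]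

theorem constFamily_zero_lie (F : ConstFamily) : ⁅(0 : ConstFamily), F⁆ = 0 := zero_lie F

theorem constFamily_lie_zero (F : ConstFamily) : ⁅F, (0 : ConstFamily)⁆ = 0 := lie_zero F

theorem constFamily_add_lie (F F' G : ConstFamily) : ⁅F + F', G⁆ = ⁅F, G⁆ + ⁅F', G⁆ :=
  add_lie F F' G

theorem constFamily_lie_add (F G G' : ConstFamily) : ⁅F, G + G'⁆ = ⁅F, G⁆ + ⁅F, G'⁆ :=
  lie_add F G G'

theorem derivAtZero_lie (k : ℕ) (F G : ConstFamily) :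
    derivAtZero k ⁅F, G⁆ = ∑ i ∈ Finset.range (k + 1),
      (k.choose i : ℂ) • ⁅derivAtZero (k - i) F, derivAtZero i G⁆ := by
  induction F using TensorProduct.induction_on with
  | zero => simp [constFamily_zero_lie]
  | add F F' hF hF' => rw [constFamily_add_lie, map_add, hF, hF']; simp [Finset.sum_add_distrib]
  | tmul f A =>
    induction G using TensorProduct.induction_on with
    | zero => simp [constFamily_lie_zero]
    | add G G' hG hG' => rw [constFamily_lie_add, map_add, hG, hG']; simp [Finset.sum_add_distrib]
    | tmul g B =>
      rw [LieAlgebra.ExtendScalars.bracket_tmul, derivAtZero_tmul,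
        Polynomial.iterate_derivative_mul, Polynomial.eval_finsetSum, Finset.sum_smul]
      refine Finset.sum_congr rfl fun i _ => ?_
      rw [derivAtZero_tmul, derivAtZero_tmul, smul_lie, lie_smul, smul_smul, smul_smul]
      simp [mul_assoc]

theorem mem_isotypic_sup_iff (A : Sl2) : A ∈ isotypic 0 ⊔ isotypic 2 ↔ toMat A 1 0 = 0 := by
  constructor
  · have key : ∀ m : ℤ, 0 ≤ m → ∀ B ∈ isotypic m, toMat B 1 0 = 0 := by
      intro m hm B hB
      have h := congrFun (congrFun (hB (Units.mk0 2 (by norm_num))) 1) 0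
      obtain ⟨j, rfl⟩ := Int.eq_ofNat_of_zero_le hm
      simp only [torus, Matrix.mul_apply, Fin.sum_univ_two] at h
      simp at h
      by_contra hne
      have h3 : (2⁻¹ * 2⁻¹ : ℂ) * toMat B 1 0 = 2 ^ j * toMat B 1 0 := by
        linear_combination h
      have h4 := mul_right_cancel₀ hne h3
      have h5 : ((1 : ℕ) : ℂ) = ((4 * 2 ^ j : ℕ) : ℂ) := by
        push_cast; rw [← h4]; norm_num
      have h6 : 1 = 4 * 2 ^ j := by exact_mod_cast h5
      omega
    intro h
    obtain ⟨B, hB, C, hC, rfl⟩ := Submodule.mem_sup.1 h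
    simp [key 0 le_rfl B hB, key 2 (by norm_num) C hC]
  · intro h
    refine Submodule.mem_sup.2
      ⟨ofEntries (toMat A 0 0) 0 0, ?_,
        ofEntries 0 (toMat A 0 1) 0, ?_, ?_⟩
    · intro z
      rw [toMat_ofEntries]
      ext i j
      fin_cases i <;> fin_cases j <;> simp [torus, Matrix.mul_apply, Fin.sum_univ_two]
      all_goals (field_simp)
    · intro z
      rw [toMat_ofEntries]
      ext i j
      fin_cases i <;> fin_cases j <;> simp [torus, Matrix.mul_apply, Fin.sum_univ_two]
      ring
    · apply toMat_injective
      rw [map_add, toMat_ofEntries, toMat_ofEntries]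
      ext i j
      fin_cases i <;> fin_cases j <;> simp [h, toMat_trace]

theorem lie_mem_isotypic_sup {A B : Sl2} (hA : A ∈ isotypic 0 ⊔ isotypic 2)
    (hB : B ∈ isotypic 0 ⊔ isotypic 2) : ⁅A, B⁆ ∈ isotypic 0 ⊔ isotypic 2 := by
  rw [mem_isotypic_sup_iff] at *
  rw [toMat_lie]
  simp [Matrix.mul_apply, Fin.sum_univ_two, hA, hB]

/-- The Lie subalgebra `𝔩(n)` over `ℂ[x]` of the constant family: the sections whose derivatives
of order less than `n` at the origin lie in `𝔤₀ ⊕ 𝔤₂`. -/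
def subfamily (n : ℕ) : LieSubalgebra ℂ[X] ConstFamily where
  carrier := {F | ∀ k < n, derivAtZero k F ∈ isotypic 0 ⊔ isotypic 2}
  zero_mem' := fun k _ => by simp
  add_mem' := fun {F G} hF hG k hk => by
    rw [map_add]; exact add_mem (hF k hk) (hG k hk)
  smul_mem' := fun p F hF k hk => by
    rw [derivAtZero_smul]
    refine Submodule.sum_mem _ fun i hi => Submodule.smul_mem _ _ (hF i ?_)
    have := Finset.mem_range.1 hi
    omega
  lie_mem' := fun {F G} hF hG k hk => by
    rw [derivAtZero_lie]
    refine Submodule.sum_mem _ fun i hi => Submodule.smul_mem _ _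
      (lie_mem_isotypic_sup (hF _ ?_) (hG _ ?_))
    · omega
    · have := Finset.mem_range.1 hi
      omega

/-- `Hₙ = 1 ⊗ H`. -/
def elemH (n : ℕ) (H : Sl2) (hH : H ∈ isotypic 0) : subfamily n :=
  ⟨1 ⊗ₜ[ℂ] H, fun k _ => by
    rw [derivAtZero_tmul]
    exact Submodule.smul_mem _ _ (Submodule.mem_sup_left hH)⟩

/-- `Xₙ = 1 ⊗ X`. -/
def elemX (n : ℕ) (E : Sl2) (hE : E ∈ isotypic 2) : subfamily n :=
  ⟨1 ⊗ₜ[ℂ] E, fun k _ => by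
    rw [derivAtZero_tmul]
    exact Submodule.smul_mem _ _ (Submodule.mem_sup_right hE)⟩

/-- `Yₙ = xⁿ ⊗ Y`. -/
def elemY (n : ℕ) (F : Sl2) : subfamily n :=
  ⟨(Polynomial.X ^ n : ℂ[X]) ⊗ₜ[ℂ] F, fun k hk => by
    rw [derivAtZero_tmul, Polynomial.iterate_derivative_X_pow_eq_smul]
    have : n - k ≠ 0 := by omega
    simp [this]⟩

/-- The Casimir element `(1/8) H² + (1/4) (X Y + Y X)` of `𝒰(𝔰𝔩₂(ℂ))`. -/
def casimir (H E F : Sl2) : UniversalEnvelopingAlgebra ℂ Sl2 :=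
  (1 / 8 : ℂ) • UniversalEnvelopingAlgebra.ι ℂ H ^ 2 +
    (1 / 4 : ℂ) • (UniversalEnvelopingAlgebra.ι ℂ E * UniversalEnvelopingAlgebra.ι ℂ F +
      UniversalEnvelopingAlgebra.ι ℂ F * UniversalEnvelopingAlgebra.ι ℂ E)

/-- The element `(xⁿ/8) h² + (1/4) (e f + f e)` of the enveloping algebra of a Lie algebra over
`ℂ[x]`. -/
def familyCasimir {L : Type*} [LieRing L] [LieAlgebra ℂ[X] L] (n : ℕ) (h e f : L) :
    UniversalEnvelopingAlgebra ℂ[X] L :=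
  (Polynomial.C (1 / 8 : ℂ) * Polynomial.X ^ n) • UniversalEnvelopingAlgebra.ι ℂ[X] h ^ 2 +
    (Polynomial.C (1 / 4 : ℂ)) •
      (UniversalEnvelopingAlgebra.ι ℂ[X] e * UniversalEnvelopingAlgebra.ι ℂ[X] f +
        UniversalEnvelopingAlgebra.ι ℂ[X] f * UniversalEnvelopingAlgebra.ι ℂ[X] e)

/-- `b = (H, X, Y)` is a basis over `ℂ[x]` of the Lie algebra `L` in which the bracket is that of
the family `𝔤(n)`. -/
structure IsFamilyBasis {L : Type*} [LieRing L] [LieAlgebra ℂ[X] L] (n : ℕ)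
    (b : Module.Basis (Fin 3) ℂ[X] L) : Prop where
  lie_H_X : ⁅b 0, b 1⁆ = (2 : ℂ[X]) • b 1
  lie_H_Y : ⁅b 0, b 2⁆ = (-2 : ℂ[X]) • b 2
  lie_X_Y : ⁅b 1, b 2⁆ = (Polynomial.X ^ n : ℂ[X]) • b 0

/-- The homomorphism `𝒰(𝔩(n)) → 𝒰(𝔤(0))` induced by the inclusion. -/
def envInclusion (n : ℕ) : UniversalEnvelopingAlgebra ℂ[X] (subfamily n) →ₐ[ℂ[X]]
    UniversalEnvelopingAlgebra ℂ[X] ConstFamily :=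
  UniversalEnvelopingAlgebra.lift ℂ[X]
    ((UniversalEnvelopingAlgebra.ι ℂ[X]).comp (subfamily n).incl)

section

attribute [local instance 2000] LieRing.ofAssociativeRing

/-- The canonical homomorphism `𝒰(ℂ[x] ⊗ 𝔤) → ℂ[x] ⊗ 𝒰(𝔤)`, sending the generator `f ⊗ A` to
`f ⊗ A`. -/
def envBaseChange : UniversalEnvelopingAlgebra ℂ[X] ConstFamily →ₐ[ℂ[X]]
    ℂ[X] ⊗[ℂ] UniversalEnvelopingAlgebra ℂ Sl2 :=
  UniversalEnvelopingAlgebra.lift ℂ[X]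
    { toLinearMap := LinearMap.baseChange ℂ[X]
        (UniversalEnvelopingAlgebra.ι ℂ : Sl2 →ₗ⁅ℂ⁆ UniversalEnvelopingAlgebra ℂ Sl2).toLinearMap
      map_lie' := by
        intro F G
        simp only [AddHom.toFun_eq_coe, LinearMap.coe_toAddHom]
        rw [LieRing.of_associative_ring_bracket]
        induction F using TensorProduct.induction_on with
        | zero => simp
        | add F F' hF hF' => rw [add_lie, map_add, hF, hF', map_add, add_mul, mul_add]; abel
        | tmul f A =>
          induction G using TensorProduct.induction_on with
          | zero => simp
          | add G G' hG hG' => rw [lie_add, map_add, hG, hG', map_add, add_mul, mul_add]; abel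
          | tmul g B =>
            simp only [LieAlgebra.ExtendScalars.bracket_tmul, LinearMap.baseChange_tmul,
              LieHom.coe_toLinearMap, LieHom.map_lie, Algebra.TensorProduct.tmul_mul_tmul]
            rw [LieRing.of_associative_ring_bracket, TensorProduct.tmul_sub, mul_comm g f] }

end

/-- The homomorphism `ℂ[x] ⊗ 𝒵(𝔤) → ℂ[x] ⊗ 𝒰(𝔤)` induced by the inclusion of the center. -/
def constCenter : ℂ[X] ⊗[ℂ] Subalgebra.center ℂ (UniversalEnvelopingAlgebra ℂ Sl2) →ₐ[ℂ[X]]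
    ℂ[X] ⊗[ℂ] UniversalEnvelopingAlgebra ℂ Sl2 :=
  Algebra.TensorProduct.map (AlgHom.id ℂ[X] ℂ[X])
    (Subalgebra.center ℂ (UniversalEnvelopingAlgebra ℂ Sl2)).val

end Sl2Family

end

/-!
The theorem rests on an explicit Poincaré–Birkhoff–Witt theorem for a Lie algebra `L` over a
commutative ring `R` with a basis `h, e, f` such that `[h, e] = 2e`, `[h, f] = -2f`, `[e, f] = t h`
(`IsDeformedBasis`). The families are the cases `R = ℂ[x]`, `t = xⁿ`, and `𝔰𝔩₂(ℂ)` is the case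
`R = ℂ`, `t = 1`.

Write elements of `𝒰(L)` as sums of ordered products `fᵃ p(h) eᶜ` with `p ∈ R[h]`. The rules
`e p(h) = p(h - 2) e`, `p(h) f = f p(h - 2)` and
`e fᵃ⁺¹ = fᵃ⁺¹ e + t (a + 1) fᵃ (h - a)` say how `h`, `e`, `f` multiply such a product from
the left. The resulting operators on the free module of formal ordered products satisfy the
relations of `L`, so `𝒰(L)` acts on it. Acting on `1` inverts the evaluation of formal products
(`wordEquiv`), which gives the basis `fᵃ hᵏ eᶜ` (`pbwBasis`).

For the center (`center_eq_adjoin_deformedCasimir`), let `z` be central. Commuting with `h` forces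
`z = ∑ fᵃ pₐ(h) eᵃ`. If `d` is the largest index with `p_d ≠ 0`, the coefficient of `fᵈ · eᵈ⁺¹` in
`e z = z e` says `p_d(h - 2) = p_d(h)`, so `p_d` is a constant `r` in characteristic zero. The
Casimir element is `Ω = ½ f e + (t / 8)(h² + 2h)`, whose `d`-th power has the leading term
`2⁻ᵈ fᵈ eᵈ`. Hence `z - r (2Ω)ᵈ` is central with smaller top index, and induction gives
`z ∈ R[Ω]`. The same leading terms show that `Ω` is transcendental. This argument never divides by
`t`, which is why the generator is `Ω` itself even where `t = xⁿ` is not invertible.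

The maps between enveloping algebras are read off on the bases: `𝒰(ℂ[x] ⊗ 𝔤) → ℂ[x] ⊗ 𝒰(𝔤)`
carries the basis to the basis (`envBaseChange_pbwBasis`), and `𝒰(𝔩(n)) → 𝒰(𝔤(0))` multiplies
each basis element by a power of `x` (`envInclusion_injective`). That `Hₙ, Xₙ, Yₙ` is a basis of
`𝔩(n)` amounts to the fact that the derivatives of order less than `n` of a polynomial vanish at
the origin exactly when `xⁿ` divides it.
-/

noncomputable section

namespace Sl2Family

attribute [local instance 100] LieRing.ofAssociativeRing

/-! ### Commutation rules for ordered products -/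

section Commutation

variable {R A : Type*} [CommRing R] [Ring A] [Algebra R A] {t : R} {h e f : A}

/-- The substitution `p(h) ↦ p(h - 2)`: moving `e` to the right past `p(h)`, or `f` to the left,
turns `p(h)` into `p(h - 2)`. -/
def shift : R[X] →ₐ[R] R[X] := Polynomial.aeval (Polynomial.X - 2)

theorem shift_X : shift (Polynomial.X : R[X]) = Polynomial.X - 2 := Polynomial.aeval_X _

theorem shift_C (r : R) : shift (Polynomial.C r) = Polynomial.C r := Polynomial.aeval_C _ r

theorem aeval_shift (p : R[X]) : Polynomial.aeval h (shift p) = Polynomial.aeval (h - 2) p := by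
  rw [shift, ← Polynomial.aeval_algHom_apply, map_sub, map_ofNat, Polynomial.aeval_X]

theorem shift_weight (a : ℕ) :
    shift (Polynomial.X - 2 * (a : R[X])) = Polynomial.X - 2 * ((a + 1 : ℕ) : R[X]) := by
  rw [map_sub, map_mul, map_natCast, map_ofNat, shift_X]
  push_cast
  ring

theorem raise_mul_aeval (he : e * h = (h - 2) * e) (p : R[X]) :
    e * Polynomial.aeval h p = Polynomial.aeval h (shift p) * e := by
  have hk (k : ℕ) : e * h ^ k = (h - 2) ^ k * e :=
    (show SemiconjBy e h (h - 2) from he).pow_right k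
  rw [aeval_shift]
  induction p using Polynomial.induction_on' with
  | add p q hp hq => simp only [map_add, mul_add, add_mul, hp, hq]
  | monomial k r =>
    simp only [Polynomial.aeval_monomial]
    rw [← mul_assoc, ← Algebra.commutes r e, mul_assoc, hk, mul_assoc]

theorem aeval_mul_lower (hf : h * f = f * (h - 2)) (p : R[X]) :
    Polynomial.aeval h p * f = f * Polynomial.aeval h (shift p) := by
  have hk (k : ℕ) : f * (h - 2) ^ k = h ^ k * f :=
    (show SemiconjBy f (h - 2) h from hf.symm).pow_right k
  rw [aeval_shift]
  induction p using Polynomial.induction_on' with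
  | add p q hp hq => simp only [map_add, mul_add, add_mul, hp, hq]
  | monomial k r =>
    simp only [Polynomial.aeval_monomial]
    rw [mul_assoc, ← hk, ← mul_assoc, Algebra.commutes r f, mul_assoc]

theorem weight_mul_lower_pow (R : Type*) [CommRing R] [Algebra R A] (hf : h * f = f * (h - 2))
    (a : ℕ) : h * f ^ a =
      f ^ a * Polynomial.aeval h (Polynomial.X - 2 * (a : R[X]) : R[X]) := by
  induction a with
  | zero => simp
  | succ a ih =>
    rw [pow_succ, ← mul_assoc, ih, mul_assoc, aeval_mul_lower hf, mul_assoc]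
    rw [shift_weight]

theorem raise_pow_mul_weight (R : Type*) [CommRing R] [Algebra R A] (he : e * h = (h - 2) * e)
    (c : ℕ) : e ^ c * h =
      Polynomial.aeval h (Polynomial.X - 2 * (c : R[X]) : R[X]) * e ^ c := by
  induction c with
  | zero => simp
  | succ c ih =>
    rw [pow_succ', mul_assoc, ih, ← mul_assoc, raise_mul_aeval he, mul_assoc]
    rw [shift_weight]

theorem raise_mul_lower_pow (hf : h * f = f * (h - 2)) (hef : e * f = f * e + t • h) (a : ℕ) :
    e * f ^ (a + 1) = f ^ (a + 1) * e + f ^ a * Polynomial.aeval h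
      (Polynomial.C t * ((a + 1 : R[X]) * (Polynomial.X - (a : R[X])))) := by
  have hef' : e * f = f * e + Polynomial.aeval h (Polynomial.C t * Polynomial.X) := by
    rw [hef, Algebra.smul_def]; simp
  induction a with
  | zero => simpa using hef'
  | succ a ih =>
    rw [pow_succ, ← mul_assoc, ih, add_mul, mul_assoc _ e f, mul_assoc _ _ f, aeval_mul_lower hf,
      hef', mul_add, ← mul_assoc _ f, ← mul_assoc _ f, ← pow_succ, ← pow_succ,
      add_assoc, ← mul_add, ← map_add]
    congr 3
    simp only [map_sub, map_mul, map_natCast, shift_X, shift_C, map_add, map_one]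
    push_cast
    ring

theorem casimir_ordered (hef : e * f = f * e + t • h) (s : R) :
    (s * t) • h ^ 2 + (2 * s) • (e * f + f * e) = (4 * s) • (f * e) +
      Polynomial.aeval h (Polynomial.C (s * t) * (Polynomial.X ^ 2 + 2 * Polynomial.X)) := by
  have h2 : Polynomial.aeval h (Polynomial.C (s * t) * (Polynomial.X ^ 2 + 2 * Polynomial.X)) =
      (s * t) • (h ^ 2 + (2 : R) • h) := by
    simp [Algebra.smul_def, map_ofNat]
  rw [hef, h2]
  module

/-- The right-hand side of `casimir_ordered` commutes with `h`, `e` and `f`. -/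
theorem commute_ordered_casimir (he : e * h = (h - 2) * e) (hf : h * f = f * (h - 2))
    (hef : e * f = f * e + t • h) (s : R) :
    let ω := (4 * s) • (f * e) +
      Polynomial.aeval h (Polynomial.C (s * t) * (Polynomial.X ^ 2 + 2 * Polynomial.X))
    ω * h = h * ω ∧ ω * e = e * ω ∧ ω * f = f * ω := by
  intro ω
  -- the correction from `[e, f] = t h` cancels the effect of the shift
  have hq : (4 * s * t) • h + Polynomial.aeval h
      (shift (Polynomial.C (s * t) * (Polynomial.X ^ 2 + 2 * Polynomial.X))) =
      Polynomial.aeval h (Polynomial.C (s * t) * (Polynomial.X ^ 2 + 2 * Polynomial.X)) := by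
    have h4 : (4 * s * t) • h = Polynomial.aeval h (Polynomial.C (4 * s * t) * Polynomial.X) := by
      rw [map_mul, Polynomial.aeval_C, Polynomial.aeval_X, Algebra.smul_def]
    rw [h4, ← map_add]
    congr 1
    have hC : (Polynomial.C (4 * s * t) : R[X]) = 4 * Polynomial.C (s * t) := by
      rw [mul_assoc, map_mul, map_ofNat]
    rw [hC, map_mul shift, map_add shift, map_pow shift, map_mul shift, shift_X, shift_C,
      map_ofNat shift]
    ring
  refine ⟨?_, ?_, ?_⟩
  · change Commute ω h
    refine Commute.add_left (Commute.smul_left ?_ _) ?_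
    · change f * e * h = h * (f * e)
      rw [mul_assoc, he, ← mul_assoc, ← mul_assoc, hf]
    · have hX (q : R[X]) : Polynomial.aeval h q * h = h * Polynomial.aeval h q := by
        simpa only [map_mul, Polynomial.aeval_X] using
          congrArg (Polynomial.aeval h) (mul_comm q Polynomial.X)
      exact hX _
  · simp only [ω]
    rw [mul_add e, raise_mul_aeval he, mul_smul_comm, ← mul_assoc, hef, ← hq]
    simp only [add_mul, smul_add, smul_mul_assoc, smul_smul, add_assoc]
  · simp only [ω]
    rw [add_mul, aeval_mul_lower hf, smul_mul_assoc, mul_assoc, hef, ← hq]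
    simp only [mul_add, smul_add, mul_smul_comm, smul_smul, add_assoc]

end Commutation

/-! ### The regular representation on ordered monomials -/

section Regular

variable {R : Type*} [CommRing R]

/-- The free module of formal sums of ordered products `fᵃ p(h) eᶜ`: such a product is encoded as
`Finsupp.single (a, c) p`. -/
abbrev OrderedWord (R : Type*) [CommRing R] : Type _ := ℕ × ℕ →₀ R[X]

/-- Left multiplication by `f` on ordered products. -/
def lowerOp : Module.End R (OrderedWord R) :=
  Finsupp.lsum R fun i => Finsupp.lsingle (i.1 + 1, i.2)

/-- Left multiplication by `h` on ordered products. -/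
def weightOp : Module.End R (OrderedWord R) :=
  Finsupp.lsum R fun i =>
    Finsupp.lsingle i ∘ₗ LinearMap.mulLeft R (Polynomial.X - 2 * (i.1 : R[X]))

/-- Left multiplication by `e` on ordered products, when `[e, f] = t h`. At `i.1 = 0` the
truncated index `i.1 - 1` carries the coefficient `0`. -/
def raiseOp (t : R) : Module.End R (OrderedWord R) :=
  Finsupp.lsum R fun i =>
    Finsupp.lsingle (i.1, i.2 + 1) ∘ₗ shift.toLinearMap +
      Finsupp.lsingle (i.1 - 1, i.2) ∘ₗ LinearMap.mulLeft R
        (Polynomial.C t * ((i.1 : R[X]) * (Polynomial.X + 1 - (i.1 : R[X]))))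

/-- Right multiplication by `e` on ordered products. -/
def raiseRightOp : Module.End R (OrderedWord R) :=
  Finsupp.lsum R fun i => Finsupp.lsingle (i.1, i.2 + 1)

/-- Right multiplication by `h` on ordered products. -/
def weightRightOp : Module.End R (OrderedWord R) :=
  Finsupp.lsum R fun i =>
    Finsupp.lsingle i ∘ₗ LinearMap.mulLeft R (Polynomial.X - 2 * (i.2 : R[X]))

theorem lowerOp_single (i : ℕ × ℕ) (p : R[X]) :
    lowerOp (Finsupp.single i p) = Finsupp.single (i.1 + 1, i.2) p := by
  simp [lowerOp]

theorem weightOp_single (i : ℕ × ℕ) (p : R[X]) :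
    weightOp (Finsupp.single i p) =
      Finsupp.single i ((Polynomial.X - 2 * (i.1 : R[X])) * p) := by
  simp [weightOp]

theorem raiseOp_single (t : R) (i : ℕ × ℕ) (p : R[X]) :
    raiseOp t (Finsupp.single i p) = Finsupp.single (i.1, i.2 + 1) (shift p) +
      Finsupp.single (i.1 - 1, i.2)
        (Polynomial.C t * ((i.1 : R[X]) * (Polynomial.X + 1 - (i.1 : R[X]))) * p) := by
  simp [raiseOp, -Finsupp.single_mul, mul_assoc]

theorem raiseRightOp_single (i : ℕ × ℕ) (p : R[X]) :
    raiseRightOp (Finsupp.single i p) = Finsupp.single (i.1, i.2 + 1) p := by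
  simp [raiseRightOp]

theorem weightRightOp_single (i : ℕ × ℕ) (p : R[X]) :
    weightRightOp (Finsupp.single i p) =
      Finsupp.single i ((Polynomial.X - 2 * (i.2 : R[X])) * p) := by
  simp [weightRightOp]

theorem weightOp_mul_raiseOp (t : R) :
    weightOp * raiseOp t = raiseOp t * weightOp + (2 : R) • raiseOp t := by
  refine Finsupp.lhom_ext fun i p => ?_
  obtain ⟨a, c⟩ := i
  simp only [Module.End.mul_apply, LinearMap.add_apply, LinearMap.smul_apply, raiseOp_single,
    weightOp_single, map_add, smul_add, Finsupp.smul_single]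
  rw [add_add_add_comm, ← Finsupp.single_add, ← Finsupp.single_add]
  congr 2
  · simp only [map_mul, map_sub, map_natCast, map_ofNat, shift_X, Algebra.smul_def,
      Polynomial.algebraMap_eq]
    ring
  · cases a with
    | zero => simp
    | succ a =>
      simp only [Algebra.smul_def, Polynomial.algebraMap_eq, map_ofNat, Nat.add_sub_cancel]
      push_cast
      ring

theorem weightOp_mul_lowerOp :
    weightOp * lowerOp = lowerOp * weightOp + (-2 : R) • (lowerOp : Module.End R _) := by
  refine Finsupp.lhom_ext fun i p => ?_
  simp only [Module.End.mul_apply, LinearMap.add_apply, LinearMap.smul_apply, lowerOp_single,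
    weightOp_single, Finsupp.smul_single]
  rw [← Finsupp.single_add]
  congr 1
  simp only [Algebra.smul_def, Polynomial.algebraMap_eq, map_neg, map_ofNat]
  push_cast
  ring

theorem raiseOp_mul_lowerOp (t : R) :
    raiseOp t * lowerOp = lowerOp * raiseOp t + t • weightOp := by
  refine Finsupp.lhom_ext fun i p => ?_
  obtain ⟨a, c⟩ := i
  simp only [Module.End.mul_apply, LinearMap.add_apply, LinearMap.smul_apply, lowerOp_single,
    raiseOp_single, weightOp_single, Finsupp.smul_single, map_add, add_assoc]
  congr 1
  have ha : Finsupp.single (a - 1 + 1, c)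
        (Polynomial.C t * ((a : R[X]) * (Polynomial.X + 1 - (a : R[X]))) * p) =
      Finsupp.single (a, c)
        (Polynomial.C t * ((a : R[X]) * (Polynomial.X + 1 - (a : R[X]))) * p) := by
    cases a with
    | zero => simp
    | succ a => rfl
  rw [ha, ← Finsupp.single_add]
  congr 1
  simp only [Algebra.smul_def, Polynomial.algebraMap_eq]
  push_cast
  ring

end Regular

/-! ### Lie algebras with a deformed `𝔰𝔩₂` basis -/

section Deformed

theorem basis_induction {R M ι : Type*} [CommRing R] [AddCommGroup M] [Module R M]
    (b : Module.Basis ι R M) {p : M → Prop} (x : M) (coe : ∀ i, p (b i)) (zero : p 0)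
    (add : ∀ y z, p y → p z → p (y + z)) (smul : ∀ (c : R) y, p y → p (c • y)) : p x :=
  Submodule.span_induction (fun _ ⟨i, hi⟩ => hi ▸ coe i) zero (fun y z _ _ => add y z)
    (fun c y _ => smul c y) (b.mem_span x)

/-- By antisymmetry, compatibility with brackets need only be checked on three pairs of basis
vectors. -/
theorem map_lie_of_basis {R L L' : Type*} [CommRing R] [LieRing L] [LieAlgebra R L] [LieRing L']
    [LieAlgebra R L'] (b : Module.Basis (Fin 3) R L) (φ : L →ₗ[R] L')
    (h01 : φ ⁅b 0, b 1⁆ = ⁅φ (b 0), φ (b 1)⁆) (h02 : φ ⁅b 0, b 2⁆ = ⁅φ (b 0), φ (b 2)⁆)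
    (h12 : φ ⁅b 1, b 2⁆ = ⁅φ (b 1), φ (b 2)⁆) (x y : L) : φ ⁅x, y⁆ = ⁅φ x, φ y⁆ := by
  have hb : ∀ i j, φ ⁅b i, b j⁆ = ⁅φ (b i), φ (b j)⁆ := by
    intro i j
    fin_cases i <;> fin_cases j <;> simp only [Fin.zero_eta, Fin.mk_one, Fin.reduceFinMk] <;>
      first
      | assumption
      | simp only [lie_self, map_zero]
      | (rw [← lie_skew, map_neg, ← lie_skew (φ _)]; congr 1)
  have hy : ∀ i y, φ ⁅b i, y⁆ = ⁅φ (b i), φ y⁆ := by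
    intro i y
    induction y using basis_induction b with
    | coe j => exact hb i j
    | zero => simp only [lie_zero, map_zero]
    | add y z hy hz => simp only [lie_add, map_add, hy, hz]
    | smul c y hy => simp only [lie_smul, map_smul, hy]
  induction x using basis_induction b with
  | coe i => exact hy i y
  | zero => simp only [zero_lie, map_zero]
  | add x z hx hz => simp only [add_lie, map_add, hx, hz]
  | smul c x hx => simp only [smul_lie, map_smul, hx]

theorem adjoin_range_ι {R L : Type*} [CommRing R] [LieRing L] [LieAlgebra R L] :
    Algebra.adjoin R (Set.range (UniversalEnvelopingAlgebra.ι R : L →ₗ⁅R⁆ _)) = ⊤ := by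
  set S := Algebra.adjoin R (Set.range (UniversalEnvelopingAlgebra.ι R : L →ₗ⁅R⁆ _))
  let g : L →ₗ⁅R⁆ S :=
    { toFun := fun x => ⟨UniversalEnvelopingAlgebra.ι R x,
        Algebra.subset_adjoin (Set.mem_range_self x)⟩
      map_add' := fun x y => Subtype.ext (map_add _ x y)
      map_smul' := fun c x => Subtype.ext (map_smul _ c x)
      map_lie' := fun {x y} => Subtype.ext (LieHom.map_lie _ x y) }
  have hg : S.val.comp (UniversalEnvelopingAlgebra.lift R g) = AlgHom.id R _ := by
    ext x
    change ((UniversalEnvelopingAlgebra.lift R g (UniversalEnvelopingAlgebra.ι R x) : S) :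
      UniversalEnvelopingAlgebra R L) = UniversalEnvelopingAlgebra.ι R x
    rw [UniversalEnvelopingAlgebra.lift_ι_apply]
    rfl
  refine eq_top_iff.2 fun u _ => ?_
  have hu : ((UniversalEnvelopingAlgebra.lift R g u : S) : UniversalEnvelopingAlgebra R L) = u :=
    DFunLike.congr_fun hg u
  exact hu ▸ (UniversalEnvelopingAlgebra.lift R g u).2

variable {R L : Type*} [CommRing R] [LieRing L] [LieAlgebra R L]

/-- The basis `b = (h, e, f)` satisfies `[h, e] = 2e`, `[h, f] = -2f` and `[e, f] = t h`. -/
structure IsDeformedBasis (t : R) (b : Module.Basis (Fin 3) R L) : Prop where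
  lie_h_e : ⁅b 0, b 1⁆ = (2 : R) • b 1
  lie_h_f : ⁅b 0, b 2⁆ = (-2 : R) • b 2
  lie_e_f : ⁅b 1, b 2⁆ = t • b 0

/-- The enveloping algebra is generated by the image of a basis of the Lie algebra. -/
theorem mem_of_basis_mem (b : Module.Basis (Fin 3) R L)
    (S : Subalgebra R (UniversalEnvelopingAlgebra R L))
    (hS : ∀ i, UniversalEnvelopingAlgebra.ι R (b i) ∈ S) (u : UniversalEnvelopingAlgebra R L) :
    u ∈ S := by
  have h : Algebra.adjoin R (Set.range (UniversalEnvelopingAlgebra.ι R : L →ₗ⁅R⁆ _)) ≤ S := by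
    refine Algebra.adjoin_le ?_
    rintro _ ⟨x, rfl⟩
    induction x using basis_induction b with
    | coe i => exact hS i
    | zero => rw [map_zero]; exact zero_mem _
    | add y z hy hz => rw [map_add]; exact add_mem hy hz
    | smul c y hy => rw [map_smul]; exact S.smul_mem hy c
  exact h (adjoin_range_ι (R := R) (L := L) ▸ Algebra.mem_top)

variable {t : R} {b : Module.Basis (Fin 3) R L}

theorem raise_weight (hb : IsDeformedBasis t b) :
    UniversalEnvelopingAlgebra.ι R (b 1) * UniversalEnvelopingAlgebra.ι R (b 0) =
      (UniversalEnvelopingAlgebra.ι R (b 0) - 2) * UniversalEnvelopingAlgebra.ι R (b 1) := by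
  have h := LieHom.map_lie (UniversalEnvelopingAlgebra.ι R) (b 0) (b 1)
  rw [hb.lie_h_e, map_smul, LieRing.of_associative_ring_bracket, Algebra.smul_def, map_ofNat] at h
  rw [sub_mul, h, sub_sub_cancel]

theorem weight_lower (hb : IsDeformedBasis t b) :
    UniversalEnvelopingAlgebra.ι R (b 0) * UniversalEnvelopingAlgebra.ι R (b 2) =
      UniversalEnvelopingAlgebra.ι R (b 2) * (UniversalEnvelopingAlgebra.ι R (b 0) - 2) := by
  have h := LieHom.map_lie (UniversalEnvelopingAlgebra.ι R) (b 0) (b 2)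
  rw [hb.lie_h_f, map_smul, LieRing.of_associative_ring_bracket, Algebra.smul_def, map_neg,
    map_ofNat] at h
  have h2 : UniversalEnvelopingAlgebra.ι R (b 2) * 2 = 2 * UniversalEnvelopingAlgebra.ι R (b 2) :=
    (Nat.cast_commute 2 _).eq.symm
  rw [mul_sub, h2, sub_eq_add_neg, ← neg_mul, h, add_sub_cancel]

theorem raise_lower (hb : IsDeformedBasis t b) :
    UniversalEnvelopingAlgebra.ι R (b 1) * UniversalEnvelopingAlgebra.ι R (b 2) =
      UniversalEnvelopingAlgebra.ι R (b 2) * UniversalEnvelopingAlgebra.ι R (b 1) +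
        t • UniversalEnvelopingAlgebra.ι R (b 0) := by
  have h := LieHom.map_lie (UniversalEnvelopingAlgebra.ι R) (b 1) (b 2)
  rw [hb.lie_e_f, map_smul, LieRing.of_associative_ring_bracket] at h
  rw [h, add_sub_cancel]

/-! ### The Poincaré–Birkhoff–Witt basis -/

/-- The representation of `L` on ordered products which becomes left multiplication. -/
def wordRep (hb : IsDeformedBasis t b) : L →ₗ⁅R⁆ Module.End R (OrderedWord R) :=
  { b.constr R ![weightOp, raiseOp t, lowerOp] with
    map_lie' := fun {x y} => by
      refine map_lie_of_basis b (b.constr R ![weightOp, raiseOp t, lowerOp]) ?_ ?_ ?_ x y <;>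
        simp only [hb.lie_h_e, hb.lie_h_f, hb.lie_e_f, map_smul, Module.Basis.constr_basis,
          Matrix.cons_val_zero, Matrix.cons_val_one, Matrix.cons_val,
          LieRing.of_associative_ring_bracket]
      · exact (sub_eq_of_eq_add' (G := Module.End R (OrderedWord R))
          (weightOp_mul_raiseOp t)).symm
      · exact (sub_eq_of_eq_add' (G := Module.End R (OrderedWord R))
          weightOp_mul_lowerOp).symm
      · exact (sub_eq_of_eq_add' (G := Module.End R (OrderedWord R))
          (raiseOp_mul_lowerOp t)).symm }

/-- The action of the enveloping algebra on ordered products. -/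
def wordAct (hb : IsDeformedBasis t b) :
    UniversalEnvelopingAlgebra R L →ₐ[R] Module.End R (OrderedWord R) :=
  UniversalEnvelopingAlgebra.lift R (wordRep hb)

theorem wordAct_weight (hb : IsDeformedBasis t b) :
    wordAct hb (UniversalEnvelopingAlgebra.ι R (b 0)) = weightOp := by
  rw [wordAct, UniversalEnvelopingAlgebra.lift_ι_apply]
  exact (b.constr_basis R _ _).trans rfl

theorem wordAct_raise (hb : IsDeformedBasis t b) :
    wordAct hb (UniversalEnvelopingAlgebra.ι R (b 1)) = raiseOp t := by
  rw [wordAct, UniversalEnvelopingAlgebra.lift_ι_apply]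
  exact (b.constr_basis R _ _).trans rfl

theorem wordAct_lower (hb : IsDeformedBasis t b) :
    wordAct hb (UniversalEnvelopingAlgebra.ι R (b 2)) = lowerOp := by
  rw [wordAct, UniversalEnvelopingAlgebra.lift_ι_apply]
  exact (b.constr_basis R _ _).trans rfl

/-- The value `fᵃ p(h) eᶜ` in the enveloping algebra of a formal ordered product. -/
def wordEval (b : Module.Basis (Fin 3) R L) : OrderedWord R →ₗ[R] UniversalEnvelopingAlgebra R L :=
  Finsupp.lsum R fun i =>
    LinearMap.mulRight R (UniversalEnvelopingAlgebra.ι R (b 1) ^ i.2) ∘ₗ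
      LinearMap.mulLeft R (UniversalEnvelopingAlgebra.ι R (b 2) ^ i.1) ∘ₗ
        (Polynomial.aeval (UniversalEnvelopingAlgebra.ι R (b 0))).toLinearMap

theorem wordEval_single (b : Module.Basis (Fin 3) R L) (i : ℕ × ℕ) (p : R[X]) :
    wordEval b (Finsupp.single i p) = UniversalEnvelopingAlgebra.ι R (b 2) ^ i.1 *
      Polynomial.aeval (UniversalEnvelopingAlgebra.ι R (b 0)) p *
        UniversalEnvelopingAlgebra.ι R (b 1) ^ i.2 := by
  simp [wordEval]

theorem wordEval_lowerOp (m : OrderedWord R) :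
    wordEval b (lowerOp m) = UniversalEnvelopingAlgebra.ι R (b 2) * wordEval b m := by
  induction m using Finsupp.induction_linear with
  | zero => simp
  | add m m' h h' => simp only [map_add, mul_add, h, h']
  | single i p => simp only [lowerOp_single, wordEval_single, pow_succ', mul_assoc]

theorem wordEval_raiseRightOp (m : OrderedWord R) :
    wordEval b (raiseRightOp m) = wordEval b m * UniversalEnvelopingAlgebra.ι R (b 1) := by
  induction m using Finsupp.induction_linear with
  | zero => simp
  | add m m' h h' => simp only [map_add, add_mul, h, h']
  | single i p => simp only [raiseRightOp_single, wordEval_single, pow_succ, mul_assoc]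

theorem wordEval_weightOp (hb : IsDeformedBasis t b) (m : OrderedWord R) :
    wordEval b (weightOp m) = UniversalEnvelopingAlgebra.ι R (b 0) * wordEval b m := by
  induction m using Finsupp.induction_linear with
  | zero => simp
  | add m m' h h' => simp only [map_add, mul_add, h, h']
  | single i p =>
    simp only [weightOp_single, wordEval_single]
    rw [← mul_assoc, ← mul_assoc, weight_mul_lower_pow R (weight_lower hb), map_mul, mul_assoc,
      mul_assoc, mul_assoc, mul_assoc]

theorem wordEval_weightRightOp (hb : IsDeformedBasis t b) (m : OrderedWord R) :
    wordEval b (weightRightOp m) = wordEval b m * UniversalEnvelopingAlgebra.ι R (b 0) := by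
  induction m using Finsupp.induction_linear with
  | zero => simp
  | add m m' h h' => simp only [map_add, add_mul, h, h']
  | single i p =>
    simp only [weightRightOp_single, wordEval_single]
    rw [mul_assoc _ _ (UniversalEnvelopingAlgebra.ι R (b 0)),
      raise_pow_mul_weight R (raise_weight hb), mul_comm _ p, map_mul]
    simp only [mul_assoc]

theorem wordEval_raiseOp (hb : IsDeformedBasis t b) (m : OrderedWord R) :
    wordEval b (raiseOp t m) = UniversalEnvelopingAlgebra.ι R (b 1) * wordEval b m := by
  induction m using Finsupp.induction_linear with
  | zero => simp
  | add m m' h h' => simp only [map_add, mul_add, h, h']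
  | single i p =>
    obtain ⟨a, c⟩ := i
    simp only [raiseOp_single, map_add, wordEval_single]
    cases a with
    | zero =>
      simp only [pow_zero, one_mul, Nat.cast_zero, zero_mul, mul_zero, map_zero, add_zero,
        pow_succ']
      rw [← mul_assoc, ← mul_assoc, raise_mul_aeval (raise_weight hb)]
    | succ a =>
      have ha : ((a + 1 : ℕ) : R[X]) * (Polynomial.X + 1 - ((a + 1 : ℕ) : R[X])) =
          (a + 1 : R[X]) * (Polynomial.X - (a : R[X])) := by
        push_cast
        ring
      rw [ha, ← mul_assoc (UniversalEnvelopingAlgebra.ι R (b 1)),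
        ← mul_assoc (UniversalEnvelopingAlgebra.ι R (b 1)),
        raise_mul_lower_pow (weight_lower hb) (raise_lower hb),
        add_mul, add_mul, mul_assoc _ _ (Polynomial.aeval _ p), raise_mul_aeval (raise_weight hb),
        mul_assoc _ _ (Polynomial.aeval _ p), ← map_mul, pow_succ' _ c, Nat.add_sub_cancel]
      simp only [add_mul, mul_assoc]

theorem wordEval_wordAct (hb : IsDeformedBasis t b) (u : UniversalEnvelopingAlgebra R L) :
    ∀ m, wordEval b (wordAct hb u m) = u * wordEval b m := by
  let S : Subalgebra R (UniversalEnvelopingAlgebra R L) :=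
    { carrier := {u | ∀ m, wordEval b (wordAct hb u m) = u * wordEval b m}
      mul_mem' := fun {u v} hu hv m => by
        rw [map_mul, Module.End.mul_apply, hu, hv, mul_assoc]
      add_mem' := fun {u v} hu hv m => by
        rw [map_add, LinearMap.add_apply, map_add, hu, hv, add_mul]
      algebraMap_mem' := fun r m => by
        rw [AlgHom.commutes, Module.algebraMap_end_apply, map_smul, Algebra.smul_def] }
  refine mem_of_basis_mem b S (fun i m => ?_) u
  fin_cases i
  · exact (wordAct_weight hb).symm ▸ wordEval_weightOp hb m
  · exact (wordAct_raise hb).symm ▸ wordEval_raiseOp hb m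
  · exact (wordAct_lower hb).symm ▸ wordEval_lowerOp m

theorem wordAct_ordered (hb : IsDeformedBasis t b) (i : ℕ × ℕ) (p : R[X]) :
    wordAct hb (wordEval b (Finsupp.single i p)) (Finsupp.single (0, 0) 1) =
      Finsupp.single i p := by
  have hE : ∀ c : ℕ, (raiseOp t ^ c) (Finsupp.single (0, 0) 1) = Finsupp.single (0, c) 1 := by
    intro c
    induction c with
    | zero => rfl
    | succ c ih => rw [pow_succ', Module.End.mul_apply, ih, raiseOp_single]; simp
  have hF : ∀ (a c : ℕ) (p : R[X]), (lowerOp ^ a) (Finsupp.single (0, c) p) =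
      Finsupp.single (a, c) p := by
    intro a c p
    induction a with
    | zero => rfl
    | succ a ih => rw [pow_succ', Module.End.mul_apply, ih, lowerOp_single]
  have hH : ∀ (c : ℕ) (p q : R[X]), (Polynomial.aeval weightOp p) (Finsupp.single (0, c) q) =
      Finsupp.single (0, c) (p * q) := by
    intro c p q
    induction p using Polynomial.induction_on generalizing q with
    | C r => simp [Module.algebraMap_end_apply, Polynomial.C_mul']
    | add p p' hp hp' => rw [map_add, LinearMap.add_apply, hp, hp', add_mul, Finsupp.single_add]
    | monomial k r ih =>
      rw [pow_succ, ← mul_assoc, map_mul, Module.End.mul_apply, Polynomial.aeval_X,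
        weightOp_single, ih]
      congr 1
      push_cast
      ring
  rw [wordEval_single, map_mul, map_mul, map_pow, map_pow, ← Polynomial.aeval_algHom_apply,
    wordAct_weight, wordAct_raise, wordAct_lower, Module.End.mul_apply, Module.End.mul_apply, hE,
    hH, hF, mul_one]

/-- The Poincaré–Birkhoff–Witt isomorphism: every element of the enveloping algebra is a unique
sum of ordered products `fᵃ p(h) eᶜ`. -/
def wordEquiv (hb : IsDeformedBasis t b) : OrderedWord R ≃ₗ[R] UniversalEnvelopingAlgebra R L :=
  LinearEquiv.ofLinearMap (wordEval b)
    (LinearMap.applyₗ (Finsupp.single (0, 0) 1) ∘ₗ (wordAct hb).toLinearMap)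
    (LinearMap.ext fun u => by
      change wordEval b (wordAct hb u _) = u
      rw [wordEval_wordAct, wordEval_single]; simp)
    (LinearMap.ext fun m => by
      change wordAct hb (wordEval b m) _ = m
      induction m using Finsupp.induction_linear with
      | zero => simp
      | add m m' h h' => rw [map_add, map_add, LinearMap.add_apply, h, h']
      | single i p => exact wordAct_ordered hb i p)

theorem wordEquiv_apply (hb : IsDeformedBasis t b) (m : OrderedWord R) :
    wordEquiv hb m = wordEval b m := rfl

/-- The Poincaré–Birkhoff–Witt basis `fᵃ hᵏ eᶜ`, indexed by `⟨(a, c), k⟩`. -/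
def pbwBasis (hb : IsDeformedBasis t b) :
    Module.Basis (Σ _ : ℕ × ℕ, ℕ) R (UniversalEnvelopingAlgebra R L) :=
  (Finsupp.basis fun _ => Polynomial.basisMonomials R).map (wordEquiv hb)

theorem pbwBasis_apply (hb : IsDeformedBasis t b) (i : Σ _ : ℕ × ℕ, ℕ) :
    pbwBasis hb i = UniversalEnvelopingAlgebra.ι R (b 2) ^ i.1.1 *
      UniversalEnvelopingAlgebra.ι R (b 0) ^ i.2 * UniversalEnvelopingAlgebra.ι R (b 1) ^ i.1.2 := by
  rw [pbwBasis, Module.Basis.map_apply, Finsupp.coe_basis, wordEquiv_apply, wordEval_single]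
  simp

end Deformed

/-! ### The center -/

section Center

variable {R L : Type*} [CommRing R] [LieRing L] [LieAlgebra R L] {t : R}
  {b : Module.Basis (Fin 3) R L}

theorem lowerOp_apply_succ (m : OrderedWord R) (a c : ℕ) : lowerOp m (a + 1, c) = m (a, c) := by
  induction m using Finsupp.induction_linear with
  | zero => simp
  | add m m' h h' => simp only [map_add, Finsupp.add_apply, h, h']
  | single i p => simp [lowerOp_single, Finsupp.single_apply, Prod.ext_iff]

theorem raiseRightOp_apply_succ (m : OrderedWord R) (a c : ℕ) :
    raiseRightOp m (a, c + 1) = m (a, c) := by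
  induction m using Finsupp.induction_linear with
  | zero => simp
  | add m m' h h' => simp only [map_add, Finsupp.add_apply, h, h']
  | single i p => simp [raiseRightOp_single, Finsupp.single_apply, Prod.ext_iff]

theorem weightOp_apply (m : OrderedWord R) (i : ℕ × ℕ) :
    weightOp m i = (Polynomial.X - 2 * (i.1 : R[X])) * m i := by
  induction m using Finsupp.induction_linear with
  | zero => simp
  | add m m' h h' => simp only [map_add, Finsupp.add_apply, h, h', mul_add]
  | single j p =>
    rw [weightOp_single, Finsupp.single_apply, Finsupp.single_apply]
    split_ifs with h
    · rw [h]
    · rw [mul_zero]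

theorem weightRightOp_apply (m : OrderedWord R) (i : ℕ × ℕ) :
    weightRightOp m i = (Polynomial.X - 2 * (i.2 : R[X])) * m i := by
  induction m using Finsupp.induction_linear with
  | zero => simp
  | add m m' h h' => simp only [map_add, Finsupp.add_apply, h, h', mul_add]
  | single j p =>
    rw [weightRightOp_single, Finsupp.single_apply, Finsupp.single_apply]
    split_ifs with h
    · rw [h]
    · rw [mul_zero]

theorem raiseOp_apply (m : OrderedWord R) (a c : ℕ) :
    raiseOp t m (a, c + 1) = shift (m (a, c)) +
      Polynomial.C t * (((a + 1 : ℕ) : R[X]) * (Polynomial.X + 1 - ((a + 1 : ℕ) : R[X]))) *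
        m (a + 1, c + 1) := by
  induction m using Finsupp.induction_linear with
  | zero => simp
  | add m m' h h' => simp only [map_add, Finsupp.add_apply, h, h', mul_add, add_add_add_comm]
  | single i p =>
    obtain ⟨a', c'⟩ := i
    rw [raiseOp_single, Finsupp.add_apply]
    congr 1
    · simp only [Finsupp.single_apply, Prod.ext_iff, Nat.add_right_cancel_iff]
      split_ifs <;> simp
    · cases a' with
      | zero => simp [Prod.ext_iff]
      | succ a' =>
        simp only [Finsupp.single_apply, Prod.ext_iff, Nat.add_right_cancel_iff,
          Nat.add_sub_cancel]
        split_ifs with h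
        · rw [h.1]
        · rw [mul_zero]

/-- If the coefficient of `fᵃ⁺¹ · eᶜ⁺¹` vanishes, that of `fᵃ · eᶜ⁺¹` in `e m` comes only from
moving `e` to the right past `fᵃ · eᶜ`. -/
theorem raiseOp_apply_succ (m : OrderedWord R) (a c : ℕ) (hm : m (a + 1, c + 1) = 0) :
    raiseOp t m (a, c + 1) = shift (m (a, c)) := by
  rw [raiseOp_apply, hm, mul_zero, add_zero]

/-- In characteristic zero a polynomial with `p(x - 2) = p(x)` is constant. -/
theorem eq_C_of_shift_eq [IsDomain R] [CharZero R] {p : R[X]} (hp : shift p = p) :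
    p = Polynomial.C (p.eval 0) := by
  have hs : ∀ x, p.eval (x - 2) = p.eval x := by
    intro x
    conv_rhs => rw [← hp]
    rw [← Polynomial.coe_aeval_eq_eval, ← Polynomial.coe_aeval_eq_eval, shift,
      ← Polynomial.aeval_algHom_apply]
    simp [map_ofNat]
  have hk : ∀ k : ℕ, p.eval (-2 * k : R) = p.eval 0 := by
    intro k
    induction k with
    | zero => simp
    | succ k ih => rw [← ih, ← hs (-2 * k)]; congr 1; push_cast; ring
  refine Polynomial.eq_of_infinite_eval_eq _ _ (Set.infinite_of_injective_forall_mem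
    (f := fun k : ℕ => (-2 * k : R)) (fun j k hjk => ?_) fun k => ?_)
  · have h2 : (-2 : R) ≠ 0 := neg_ne_zero.2 two_ne_zero
    exact Nat.cast_injective (mul_left_cancel₀ h2 hjk)
  · simp only [Set.mem_ofPred_eq, Polynomial.eval_C]
    exact hk k

/-- The Casimir element `(s t) h² + 2 s (e f + f e)`. The usual normalization is `s = 1 / 8`; the
scalar is a parameter because `8` need not be invertible in `R`. -/
def deformedCasimir (s t : R) (b : Module.Basis (Fin 3) R L) : UniversalEnvelopingAlgebra R L :=
  (s * t) • UniversalEnvelopingAlgebra.ι R (b 0) ^ 2 +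
    (2 * s) • (UniversalEnvelopingAlgebra.ι R (b 1) * UniversalEnvelopingAlgebra.ι R (b 2) +
      UniversalEnvelopingAlgebra.ι R (b 2) * UniversalEnvelopingAlgebra.ι R (b 1))

theorem deformedCasimir_eq (hb : IsDeformedBasis t b) (s : R) : deformedCasimir s t b =
    (4 * s) • (UniversalEnvelopingAlgebra.ι R (b 2) * UniversalEnvelopingAlgebra.ι R (b 1)) +
      Polynomial.aeval (UniversalEnvelopingAlgebra.ι R (b 0))
        (Polynomial.C (s * t) * (Polynomial.X ^ 2 + 2 * Polynomial.X)) :=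
  casimir_ordered (raise_lower hb) s

theorem deformedCasimir_mem_center (hb : IsDeformedBasis t b) (s : R) :
    deformedCasimir s t b ∈ Subalgebra.center R (UniversalEnvelopingAlgebra R L) := by
  have hc := commute_ordered_casimir (raise_weight hb) (weight_lower hb) (raise_lower hb) s
  rw [← deformedCasimir_eq hb] at hc
  rw [Subalgebra.mem_center_iff]
  intro u
  have hu := mem_of_basis_mem b (Subalgebra.centralizer R {deformedCasimir s t b})
      (fun i => (Subalgebra.mem_centralizer_iff R).2 fun g hg => by
        rw [Set.mem_singleton_iff.1 hg]
        fin_cases i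
        exacts [hc.1, hc.2.1, hc.2.2]) u
  exact ((Subalgebra.mem_centralizer_iff R).1 hu _ rfl).symm

/-- The diagonal coefficients of the powers of the Casimir element: the `d`-th power has leading
term `(4 s)ᵈ fᵈ eᵈ`. -/
theorem deformedCasimir_pow_coeff (hb : IsDeformedBasis t b) (s : R) (d : ℕ) :
    (∀ a, d < a → (wordEquiv hb).symm (deformedCasimir s t b ^ d) (a, a) = 0) ∧
      (wordEquiv hb).symm (deformedCasimir s t b ^ d) (d, d) = Polynomial.C ((4 * s) ^ d) := by
  have hmul : ∀ (u : UniversalEnvelopingAlgebra R L) (a : ℕ),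
      (wordEquiv hb).symm u (a + 1, a + 1) = 0 →
      (wordEquiv hb).symm (deformedCasimir s t b * u) (a + 1, a + 1) =
        Polynomial.C (4 * s) * shift ((wordEquiv hb).symm u (a, a)) := by
    intro u a hu
    obtain ⟨m, rfl⟩ := (wordEquiv hb).surjective u
    rw [LinearEquiv.symm_apply_apply] at hu ⊢
    have h1 : deformedCasimir s t b * wordEquiv hb m =
        wordEquiv hb ((4 * s) • lowerOp (raiseOp t m) +
          (s * t) • (weightOp (weightOp m) + (2 : R) • weightOp m)) := by
      rw [deformedCasimir_eq hb]
      simp only [wordEquiv_apply, map_add, map_smul, wordEval_lowerOp, wordEval_raiseOp hb,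
        wordEval_weightOp hb, map_mul, Polynomial.aeval_C, Polynomial.aeval_X, map_ofNat,
        add_mul, mul_assoc, Algebra.smul_def, pow_two]
    rw [h1, LinearEquiv.symm_apply_apply, Finsupp.add_apply, Finsupp.smul_apply, lowerOp_apply_succ,
      raiseOp_apply_succ m a a hu, Finsupp.smul_apply, Finsupp.add_apply, Finsupp.smul_apply,
      weightOp_apply, weightOp_apply, hu]
    simp [Polynomial.smul_eq_C_mul]
  induction d with
  | zero =>
    have h1 : (1 : UniversalEnvelopingAlgebra R L) = wordEquiv hb (Finsupp.single (0, 0) 1) := by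
      rw [wordEquiv_apply, wordEval_single]; simp
    rw [pow_zero, h1, LinearEquiv.symm_apply_apply]
    refine ⟨fun a ha => ?_, by simp⟩
    rw [Finsupp.single_eq_of_ne]
    simp [Prod.ext_iff]
    omega
  | succ d ih =>
    refine ⟨fun a ha => ?_, ?_⟩
    · obtain ⟨a, rfl⟩ : ∃ k, a = k + 1 := ⟨a - 1, by omega⟩
      rw [pow_succ', hmul _ _ (ih.1 _ (by omega)), ih.1 _ (by omega), map_zero, mul_zero]
    · rw [pow_succ', hmul _ _ (ih.1 _ (by omega)), ih.2, shift_C, ← Polynomial.C_mul, pow_succ']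

/-- The top diagonal coefficient of a central element is invariant under the shift, hence
constant. -/
theorem shift_coeff_of_mem_center (hb : IsDeformedBasis t b) {u : UniversalEnvelopingAlgebra R L}
    (hu : u ∈ Subalgebra.center R (UniversalEnvelopingAlgebra R L)) {d : ℕ}
    (hd : (wordEquiv hb).symm u (d + 1, d + 1) = 0) :
    shift ((wordEquiv hb).symm u (d, d)) = (wordEquiv hb).symm u (d, d) := by
  obtain ⟨m, rfl⟩ := (wordEquiv hb).surjective u
  rw [LinearEquiv.symm_apply_apply] at hd ⊢
  have h1 : raiseOp t m = raiseRightOp m := by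
    apply (wordEquiv hb).injective
    rw [wordEquiv_apply, wordEquiv_apply, wordEval_raiseOp hb, wordEval_raiseRightOp]
    exact Subalgebra.mem_center_iff.1 hu _
  rw [← raiseOp_apply_succ m d d hd, h1, raiseRightOp_apply_succ]

variable [IsDomain R] [CharZero R]

theorem transcendental_deformedCasimir (hb : IsDeformedBasis t b) {s : R} (hs : s ≠ 0) :
    Transcendental R (deformedCasimir s t b) := by
  rw [transcendental_iff]
  intro p hp
  by_contra hne
  have hcoeff : (wordEquiv hb).symm (Polynomial.aeval (deformedCasimir s t b) p)
      (p.natDegree, p.natDegree) =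
        Polynomial.C (p.leadingCoeff * (4 * s) ^ p.natDegree) := by
    rw [Polynomial.aeval_eq_sum_range, map_sum, Finsupp.finsetSum_apply, Finset.sum_range_succ,
      Finset.sum_eq_zero, zero_add, map_smul, Finsupp.smul_apply,
      (deformedCasimir_pow_coeff hb s _).2, Polynomial.smul_C, smul_eq_mul,
      Polynomial.leadingCoeff]
    intro k hk
    rw [map_smul, Finsupp.smul_apply,
      (deformedCasimir_pow_coeff hb s k).1 _ (Finset.mem_range.1 hk), smul_zero]
  rw [hp, map_zero, Finsupp.zero_apply, eq_comm, Polynomial.C_eq_zero] at hcoeff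
  exact mul_ne_zero (Polynomial.leadingCoeff_ne_zero.2 hne)
    (pow_ne_zero _ (mul_ne_zero (OfNat.ofNat_ne_zero 4) hs)) hcoeff

/-- A central element has weight zero, so only the diagonal coefficients occur. -/
theorem coeff_eq_zero_of_mem_center (hb : IsDeformedBasis t b) {u : UniversalEnvelopingAlgebra R L}
    (hu : u ∈ Subalgebra.center R (UniversalEnvelopingAlgebra R L)) {i : ℕ × ℕ} (hi : i.1 ≠ i.2) :
    (wordEquiv hb).symm u i = 0 := by
  obtain ⟨m, rfl⟩ := (wordEquiv hb).surjective u
  rw [LinearEquiv.symm_apply_apply]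
  have h1 : weightOp m = weightRightOp m := by
    apply (wordEquiv hb).injective
    rw [wordEquiv_apply, wordEquiv_apply, wordEval_weightOp hb, wordEval_weightRightOp hb]
    exact Subalgebra.mem_center_iff.1 hu _
  have h2 := DFunLike.congr_fun h1 i
  rw [weightOp_apply, weightRightOp_apply] at h2
  by_contra hne
  have h3 := mul_right_cancel₀ hne h2
  have h4 : (i.1 : R[X]) = i.2 := by
    have h5 : (2 : R[X]) * i.1 = 2 * i.2 := by linear_combination -h3
    exact mul_left_cancel₀ two_ne_zero h5
  exact hi (Nat.cast_injective h4)

theorem center_eq_adjoin_deformedCasimir (hb : IsDeformedBasis t b) {s : R} (hs : 8 * s = 1) :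
    Subalgebra.center R (UniversalEnvelopingAlgebra R L) =
      Algebra.adjoin R {deformedCasimir s t b} := by
  refine le_antisymm ?_ (Algebra.adjoin_le
    (Set.singleton_subset_iff.2 (deformedCasimir_mem_center hb s)))
  have main : ∀ (d : ℕ) (u : UniversalEnvelopingAlgebra R L),
      u ∈ Subalgebra.center R (UniversalEnvelopingAlgebra R L) →
      (∀ a, d ≤ a → (wordEquiv hb).symm u (a, a) = 0) →
      u ∈ Algebra.adjoin R {deformedCasimir s t b} := by
    intro d
    induction d with
    | zero =>
      intro u hu h0
      have : (wordEquiv hb).symm u = 0 := by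
        ext1 ⟨a, c⟩
        by_cases hac : a = c
        · exact hac ▸ h0 a (Nat.zero_le a)
        · exact coeff_eq_zero_of_mem_center hb hu hac
      rw [(LinearEquiv.map_eq_zero_iff _).1 this]
      exact zero_mem _
    | succ d ih =>
      intro u hu h0
      obtain ⟨r, hr⟩ : ∃ r, (wordEquiv hb).symm u (d, d) = Polynomial.C r :=
        ⟨_, eq_C_of_shift_eq (shift_coeff_of_mem_center hb hu (h0 _ le_rfl))⟩
      -- `2` is inverse to `4 s`, so this multiple of `Ωᵈ` has top coefficient `r`
      have hmem : (r * 2 ^ d) • deformedCasimir s t b ^ d ∈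
          Algebra.adjoin R {deformedCasimir s t b} :=
        Subalgebra.smul_mem _ (pow_mem (Algebra.self_mem_adjoin_singleton R _) d) _
      have hcen : (r * 2 ^ d) • deformedCasimir s t b ^ d ∈
          Subalgebra.center R (UniversalEnvelopingAlgebra R L) :=
        Subalgebra.smul_mem _ (pow_mem (deformedCasimir_mem_center hb s) d) _
      have hsub := ih (u - (r * 2 ^ d) • deformedCasimir s t b ^ d) (sub_mem hu hcen) ?_
      · simpa using add_mem hsub hmem
      · intro a ha
        rw [map_sub, map_smul, Finsupp.sub_apply, Finsupp.smul_apply]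
        rcases ha.eq_or_lt with rfl | ha
        · rw [hr, (deformedCasimir_pow_coeff hb s _).2, Polynomial.smul_C, smul_eq_mul, mul_assoc,
            ← mul_pow, ← mul_assoc, show (2 * 4 * s : R) = 1 by linear_combination hs, one_pow,
            mul_one, sub_self]
        · rw [(deformedCasimir_pow_coeff hb s d).1 a ha, smul_zero, h0 a ha, sub_zero]
  intro u hu
  obtain ⟨d, hd⟩ := (((wordEquiv hb).symm u).support.image Prod.fst).bddAbove
  refine main (d + 1) u hu fun a ha => ?_
  by_contra hne
  have := hd (Finset.mem_coe.2 (Finset.mem_image_of_mem Prod.fst (Finsupp.mem_support_iff.2 hne)))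
  simp only at this
  omega

end Center

/-! ### Bases of the families -/

section Bases

theorem injective_of_basis_map_smul {R M M' ι : Type*} [CommRing R] [IsDomain R] [AddCommGroup M]
    [Module R M] [AddCommGroup M'] [Module R M'] (b : Module.Basis ι R M)
    (b' : Module.Basis ι R M') (c : ι → R) (hc : ∀ i, c i ≠ 0) (φ : M →ₗ[R] M')
    (hφ : ∀ i, φ (b i) = c i • b' i) : Function.Injective φ := by
  classical
  have key : ∀ u i, b'.repr (φ u) i = c i * b.repr u i := by
    intro u i
    induction u using basis_induction b with
    | coe j =>
      rw [hφ, map_smul, Finsupp.smul_apply, b'.repr_self, b.repr_self, smul_eq_mul,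
        Finsupp.single_apply]
      split_ifs with h
      · rw [h]
      · rw [mul_zero, mul_zero]
    | zero => simp
    | add y z hy hz => simp only [map_add, Finsupp.add_apply, hy, hz, mul_add]
    | smul r y hy =>
      simp only [map_smul, Finsupp.smul_apply, smul_eq_mul, hy]
      ring
  refine (injective_iff_map_eq_zero φ).2 fun u hu => ?_
  refine b.repr.map_eq_zero_iff.1 (Finsupp.ext fun i => ?_)
  have h := key u i
  rw [hu, map_zero, Finsupp.zero_apply, eq_comm] at h
  exact (mul_eq_zero.1 h).resolve_left (hc i)

/-- Comparing entries for the torus element `k(2)`. -/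
theorem isotypic_entry {m : ℤ} {A : Sl2} (hA : A ∈ isotypic m) :
    toMat A 0 0 = (2 : ℂ) ^ m * toMat A 0 0 ∧ 4 * toMat A 0 1 = (2 : ℂ) ^ m * toMat A 0 1 ∧
      toMat A 1 0 = 4 * (2 : ℂ) ^ m * toMat A 1 0 := by
  have h := hA (Units.mk0 2 two_ne_zero)
  have h00 := congrFun (congrFun h 0) 0
  have h01 := congrFun (congrFun h 0) 1
  have h10 := congrFun (congrFun h 1) 0
  simp only [torus, Matrix.mul_apply, Fin.sum_univ_two] at h00 h01 h10
  simp at h00 h01 h10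
  refine ⟨?_, ?_, ?_⟩
  · linear_combination h00
  · linear_combination h01
  · linear_combination 4 * h10

variable {H E F : Sl2}

/-- The matrices of a standard triple adapted to the torus: `H = diag(1, -1)`, and `X`, `Y` have a
single nonzero entry, these being inverse to each other. -/
theorem toMat_triple (hH : H ∈ isotypic 0) (hE : E ∈ isotypic 2) (hF : F ∈ isotypic (-2))
    (hHEF : IsSl2Triple H E F) : ∃ β γ : ℂ, β * γ = 1 ∧ toMat H = !![1, 0; 0, -1] ∧
      toMat E = !![0, β; 0, 0] ∧ toMat F = !![0, 0; γ, 0] := by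
  obtain ⟨-, hH01, hH10⟩ := isotypic_entry hH
  obtain ⟨hE00, -, hE10⟩ := isotypic_entry hE
  obtain ⟨hF00, hF01, -⟩ := isotypic_entry hF
  have p2 : (2 : ℂ) ^ (2 : ℤ) = 4 := by norm_num
  have pm2 : (2 : ℂ) ^ (-2 : ℤ) = 1 / 4 := by norm_num [zpow_neg]
  rw [zpow_zero] at hH01 hH10
  rw [p2] at hE00 hE10
  rw [pm2] at hF00 hF01
  have hH01 : toMat H 0 1 = 0 := by linear_combination (1 / 3) * hH01
  have hH10 : toMat H 1 0 = 0 := by linear_combination (-1 / 3) * hH10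
  have hE00 : toMat E 0 0 = 0 := by linear_combination (-1 / 3) * hE00
  have hE10 : toMat E 1 0 = 0 := by linear_combination (-1 / 15) * hE10
  have hF00 : toMat F 0 0 = 0 := by linear_combination (4 / 3) * hF00
  have hF01 : toMat F 0 1 = 0 := by linear_combination (4 / 15) * hF01
  have hbr := congrFun (congrFun (congrArg toMat hHEF.lie_e_f) 0) 0
  have hbr' := congrFun (congrFun (congrArg toMat hHEF.lie_h_e_nsmul) 0) 1
  rw [toMat_lie] at hbr hbr'
  rw [map_nsmul] at hbr'
  simp [Matrix.mul_apply, Fin.sum_univ_two, hE00, hF01, hH01, toMat_trace] at hbr hbr'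
  have hH0 : toMat H 0 0 ≠ 0 := by
    intro h0
    apply hHEF.h_ne_zero
    apply toMat_injective
    ext i j
    fin_cases i <;> fin_cases j <;> simp [h0, hH01, hH10, toMat_trace]
  have hE01 : toMat E 0 1 ≠ 0 := by
    intro h0
    rw [h0, zero_mul] at hbr
    exact hH0 hbr.symm
  have hH1 : toMat H 0 0 = 1 := by
    apply mul_right_cancel₀ hE01
    linear_combination (1 / 2) * hbr'
  refine ⟨toMat E 0 1, toMat F 1 0, hbr.trans hH1, ?_, ?_, ?_⟩ <;>
    (ext i j; fin_cases i <;> fin_cases j <;>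
      simp [hH1, hH01, hH10, hE00, hE10, hF00, hF01, toMat_trace])

theorem exists_sl2_basis (hH : H ∈ isotypic 0) (hE : E ∈ isotypic 2) (hF : F ∈ isotypic (-2))
    (hHEF : IsSl2Triple H E F) :
    ∃ b : Module.Basis (Fin 3) ℂ Sl2, b 0 = H ∧ b 1 = E ∧ b 2 = F := by
  obtain ⟨β, γ, hβγ, mH, mE, mF⟩ := toMat_triple hH hE hF hHEF
  have hβ : β ≠ 0 := left_ne_zero_of_mul_eq_one hβγ
  have hγ : γ ≠ 0 := right_ne_zero_of_mul_eq_one hβγ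
  have li : LinearIndependent ℂ ![H, E, F] := by
    rw [Fintype.linearIndependent_iff]
    intro g hg
    rw [Fin.sum_univ_three] at hg
    have h := congrArg toMat hg
    simp only [Matrix.cons_val, map_add, map_smul, mH, mE, mF, map_zero] at h
    have h00 := congrFun (congrFun h 0) 0
    have h01 := congrFun (congrFun h 0) 1
    have h10 := congrFun (congrFun h 1) 0
    simp [hβ, hγ] at h00 h01 h10
    intro i
    fin_cases i
    exacts [h00, h01, h10]
  have sp : ⊤ ≤ Submodule.span ℂ (Set.range ![H, E, F]) := by
    intro A _
    have hA : A = toMat A 0 0 • H + (toMat A 0 1 * γ) • E + (toMat A 1 0 * β) • F := by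
      apply toMat_injective
      simp only [map_add, map_smul, mH, mE, mF]
      ext i j
      fin_cases i <;> fin_cases j <;> simp [toMat_trace, mul_assoc, hβγ, mul_comm γ β]
    rw [hA]
    refine add_mem (add_mem ?_ ?_) ?_ <;> refine Submodule.smul_mem _ _ (Submodule.subset_span ?_)
    exacts [⟨0, rfl⟩, ⟨1, rfl⟩, ⟨2, rfl⟩]
  refine ⟨Module.Basis.mk li sp, ?_, ?_, ?_⟩ <;> rw [Module.Basis.mk_apply] <;> rfl

theorem isDeformedBasis_sl2 (hHEF : IsSl2Triple H E F) {b : Module.Basis (Fin 3) ℂ Sl2}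
    (h0 : b 0 = H) (h1 : b 1 = E) (h2 : b 2 = F) : IsDeformedBasis 1 b where
  lie_h_e := by rw [h0, h1, hHEF.lie_h_e_nsmul, ofNat_smul_eq_nsmul ℂ 2]
  lie_h_f := by rw [h0, h2, hHEF.lie_h_f_nsmul, neg_smul, ofNat_smul_eq_nsmul ℂ 2]
  lie_e_f := by rw [h0, h1, h2, hHEF.lie_e_f, one_smul]

/-- The basis `1 ⊗ bᵢ` of the constant family. -/
def constBasis (b : Module.Basis (Fin 3) ℂ Sl2) : Module.Basis (Fin 3) ℂ[X] ConstFamily :=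
  Algebra.TensorProduct.basis ℂ[X] b

theorem constBasis_apply (b : Module.Basis (Fin 3) ℂ Sl2) (i : Fin 3) :
    constBasis b i = 1 ⊗ₜ[ℂ] b i :=
  Algebra.TensorProduct.basis_apply b i

theorem isDeformedBasis_constBasis {b : Module.Basis (Fin 3) ℂ Sl2} (hb : IsDeformedBasis 1 b) :
    IsDeformedBasis (1 : ℂ[X]) (constBasis b) where
  lie_h_e := by
    simp only [constBasis_apply, LieAlgebra.ExtendScalars.bracket_tmul, hb.lie_h_e, mul_one,
      ofNat_smul_eq_nsmul, TensorProduct.tmul_smul]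
  lie_h_f := by
    simp only [constBasis_apply, LieAlgebra.ExtendScalars.bracket_tmul, hb.lie_h_f, mul_one,
      neg_smul, ofNat_smul_eq_nsmul, TensorProduct.tmul_smul, TensorProduct.tmul_neg]
  lie_e_f := by
    simp only [constBasis_apply, LieAlgebra.ExtendScalars.bracket_tmul, hb.lie_e_f, mul_one,
      one_smul]

theorem IsFamilyBasis.isDeformedBasis {L : Type*} [LieRing L] [LieAlgebra ℂ[X] L] {n : ℕ}
    {b : Module.Basis (Fin 3) ℂ[X] L} (hb : IsFamilyBasis n b) :
    IsDeformedBasis (Polynomial.X ^ n) b :=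
  ⟨hb.lie_H_X, hb.lie_H_Y, hb.lie_X_Y⟩

theorem constFamily_lie_smul (p : ℂ[X]) (F G : ConstFamily) : ⁅F, p • G⁆ = p • ⁅F, G⁆ :=
  lie_smul p F G

theorem exists_subfamily_basis (n : ℕ) (hH : H ∈ isotypic 0) (hE : E ∈ isotypic 2)
    (hF : F ∈ isotypic (-2)) (hHEF : IsSl2Triple H E F) :
    ∃ b : Module.Basis (Fin 3) ℂ[X] (subfamily n), IsFamilyBasis n b ∧ b 0 = elemH n H hH ∧
      b 1 = elemX n E hE ∧ b 2 = elemY n F := by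
  obtain ⟨b, h0, h1, h2⟩ := exists_sl2_basis hH hE hF hHEF
  obtain ⟨β, γ, hβγ, mH, mE, mF⟩ := toMat_triple hH hE hF hHEF
  have hc := isDeformedBasis_constBasis (isDeformedBasis_sl2 hHEF h0 h1 h2)
  have c0 : constBasis b 0 = 1 ⊗ₜ[ℂ] H := by rw [constBasis_apply, h0]
  have c1 : constBasis b 1 = 1 ⊗ₜ[ℂ] E := by rw [constBasis_apply, h1]
  have c2 : constBasis b 2 = 1 ⊗ₜ[ℂ] F := by rw [constBasis_apply, h2]
  have eH : (elemH n H hH : ConstFamily) = constBasis b 0 := c0.symm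
  have eX : (elemX n E hE : ConstFamily) = constBasis b 1 := c1.symm
  have eY : (elemY n F : ConstFamily) = (Polynomial.X ^ n : ℂ[X]) • constBasis b 2 := by
    rw [c2, TensorProduct.smul_tmul', smul_eq_mul, mul_one]; rfl
  have li : LinearIndependent ℂ[X] ![elemH n H hH, elemX n E hE, elemY n F] := by
    rw [Fintype.linearIndependent_iff]
    intro g hg
    have hg' := congrArg (subfamily n).subtype hg
    have hli := Fintype.linearIndependent_iff.1 (constBasis b).linearIndependent
      ![g 0, g 1, g 2 * Polynomial.X ^ n] (by
        rw [Fin.sum_univ_three] at hg' ⊢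
        simp only [Matrix.cons_val, mul_smul, ← eY, ← eH, ← eX]
        exact hg')
    intro i
    fin_cases i
    · exact hli 0
    · exact hli 1
    · exact (mul_eq_zero.1 (hli 2)).resolve_right (pow_ne_zero _ Polynomial.X_ne_zero)
  have sp : ⊤ ≤ Submodule.span ℂ[X] (Set.range ![elemH n H hH, elemX n E hE, elemY n F]) := by
    rintro ⟨G, hG⟩ -
    have hsum := (constBasis b).sum_repr G
    rw [Fin.sum_univ_three] at hsum
    set r := (constBasis b).repr G
    have hdvd : (Polynomial.X ^ n : ℂ[X]) ∣ r 2 := by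
      rw [Polynomial.X_pow_dvd_iff]
      intro k hk
      have hk' := (mem_isotypic_sup_iff _).1 (hG k hk)
      rw [← hsum, c0, c1, c2] at hk'
      simp only [TensorProduct.smul_tmul', smul_eq_mul, mul_one, map_add, derivAtZero_tmul,
        map_smul, mH, mE, mF] at hk'
      simp only [Matrix.add_apply, Matrix.smul_apply] at hk'
      simp [right_ne_zero_of_mul_eq_one hβγ, ← Polynomial.coeff_zero_eq_eval_zero,
        Polynomial.coeff_iterate_derivative, Nat.descFactorial_self, Nat.factorial_ne_zero] at hk'
      exact hk'
    obtain ⟨q, hq⟩ := hdvd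
    have hG' : (⟨G, hG⟩ : subfamily n) =
        r 0 • elemH n H hH + r 1 • elemX n E hE + q • elemY n F := by
      apply Subtype.ext
      change G = r 0 • (elemH n H hH : ConstFamily) + r 1 • (elemX n E hE : ConstFamily) +
        q • (elemY n F : ConstFamily)
      rw [eH, eX, eY, smul_smul, mul_comm q, ← hq, hsum]
    rw [hG']
    refine add_mem (add_mem ?_ ?_) ?_ <;> refine Submodule.smul_mem _ _ (Submodule.subset_span ?_)
    exacts [⟨0, rfl⟩, ⟨1, rfl⟩, ⟨2, rfl⟩]
  have m0 : Module.Basis.mk li sp 0 = elemH n H hH := Module.Basis.mk_apply li sp 0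
  have m1 : Module.Basis.mk li sp 1 = elemX n E hE := Module.Basis.mk_apply li sp 1
  have m2 : Module.Basis.mk li sp 2 = elemY n F := Module.Basis.mk_apply li sp 2
  refine ⟨Module.Basis.mk li sp, ⟨?_, ?_, ?_⟩, m0, m1, m2⟩
  · rw [m0, m1]
    apply Subtype.ext
    change ⁅(elemH n H hH : ConstFamily), (elemX n E hE : ConstFamily)⁆ =
      (2 : ℂ[X]) • (elemX n E hE : ConstFamily)
    rw [eH, eX, hc.lie_h_e]
  · rw [m0, m2]
    apply Subtype.ext
    change ⁅(elemH n H hH : ConstFamily), (elemY n F : ConstFamily)⁆ =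
      (-2 : ℂ[X]) • (elemY n F : ConstFamily)
    rw [eH, eY, constFamily_lie_smul, hc.lie_h_f, smul_comm]
  · rw [m0, m1, m2]
    apply Subtype.ext
    change ⁅(elemX n E hE : ConstFamily), (elemY n F : ConstFamily)⁆ =
      (Polynomial.X ^ n : ℂ[X]) • (elemH n H hH : ConstFamily)
    rw [eH, eX, eY, constFamily_lie_smul, hc.lie_e_f, one_smul]

end Bases

/-! ### Comparison of the enveloping algebras -/

section Comparison

theorem familyCasimir_eq {L : Type*} [LieRing L] [LieAlgebra ℂ[X] L] (n : ℕ)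
    (b : Module.Basis (Fin 3) ℂ[X] L) : familyCasimir n (b 0) (b 1) (b 2) =
      deformedCasimir (Polynomial.C (1 / 8)) (Polynomial.X ^ n) b := by
  have h4 : (Polynomial.C (1 / 4) : ℂ[X]) = 2 * Polynomial.C (1 / 8) := by
    rw [← Polynomial.C_ofNat, ← Polynomial.C_mul]; norm_num
  rw [familyCasimir, h4]; rfl

theorem casimir_eq (b : Module.Basis (Fin 3) ℂ Sl2) :
    casimir (b 0) (b 1) (b 2) = deformedCasimir (1 / 8) 1 b := by
  rw [casimir, deformedCasimir]; norm_num

theorem eight_mul_C : (8 : ℂ[X]) * Polynomial.C (1 / 8) = 1 := by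
  rw [← Polynomial.C_ofNat, ← Polynomial.C_mul]; norm_num

theorem envBaseChange_ι (f : ℂ[X]) (A : Sl2) :
    envBaseChange (UniversalEnvelopingAlgebra.ι ℂ[X] (f ⊗ₜ[ℂ] A)) =
      f ⊗ₜ[ℂ] UniversalEnvelopingAlgebra.ι ℂ A :=
  UniversalEnvelopingAlgebra.lift_ι_apply _ _ _

theorem envInclusion_ι (n : ℕ) (G : subfamily n) :
    envInclusion n (UniversalEnvelopingAlgebra.ι ℂ[X] G) =
      UniversalEnvelopingAlgebra.ι ℂ[X] (G : ConstFamily) :=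
  UniversalEnvelopingAlgebra.lift_ι_apply _ _ _

/-- `𝒰(ℂ[x] ⊗ 𝔤) → ℂ[x] ⊗ 𝒰(𝔤)` matches the Poincaré–Birkhoff–Witt bases. -/
theorem envBaseChange_pbwBasis {b : Module.Basis (Fin 3) ℂ Sl2} (hb : IsDeformedBasis 1 b)
    (i : Σ _ : ℕ × ℕ, ℕ) : envBaseChange (pbwBasis (isDeformedBasis_constBasis hb) i) =
      1 ⊗ₜ[ℂ] pbwBasis hb i := by
  simp only [pbwBasis_apply, constBasis_apply, map_mul, map_pow, envBaseChange_ι,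
    Algebra.TensorProduct.tmul_pow, Algebra.TensorProduct.tmul_mul_tmul, one_pow, mul_one]

theorem envBaseChange_bijective {b : Module.Basis (Fin 3) ℂ Sl2} (hb : IsDeformedBasis 1 b) :
    Function.Bijective envBaseChange := by
  let e := (pbwBasis (isDeformedBasis_constBasis hb)).equiv
    (Algebra.TensorProduct.basis ℂ[X] (pbwBasis hb)) (Equiv.refl _)
  have h : envBaseChange.toLinearMap = e.toLinearMap :=
    (pbwBasis (isDeformedBasis_constBasis hb)).ext fun i => by
      simp [e, envBaseChange_pbwBasis hb]
  have h' : ⇑envBaseChange = e := funext fun u => DFunLike.congr_fun h u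
  rw [h']
  exact e.bijective

theorem constCenter_injective : Function.Injective constCenter :=
  Module.Flat.lTensor_preserves_injective_linearMap (M := ℂ[X])
    (Subalgebra.center ℂ (UniversalEnvelopingAlgebra ℂ Sl2)).val.toLinearMap
    Subtype.val_injective

theorem constCenter_range {b : Module.Basis (Fin 3) ℂ Sl2} (hb : IsDeformedBasis 1 b) :
    constCenter.range =
      Algebra.adjoin ℂ[X] {(1 : ℂ[X]) ⊗ₜ[ℂ] deformedCasimir (1 / 8 : ℂ) 1 b} := by
  have hcen := center_eq_adjoin_deformedCasimir hb (s := (1 / 8 : ℂ)) (by norm_num)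
  refine le_antisymm ?_ (Algebra.adjoin_le (Set.singleton_subset_iff.2
    ⟨1 ⊗ₜ[ℂ] ⟨_, deformedCasimir_mem_center hb (1 / 8)⟩, rfl⟩))
  rintro _ ⟨w, rfl⟩
  induction w using TensorProduct.induction_on with
  | zero => exact (map_zero constCenter.toRingHom).symm ▸ zero_mem _
  | add w w' h h' => exact (map_add constCenter.toRingHom w w').symm ▸ add_mem h h'
  | tmul p z =>
    change p ⊗ₜ[ℂ] (z : UniversalEnvelopingAlgebra ℂ Sl2) ∈ _
    have hle : Algebra.adjoin ℂ {deformedCasimir (1 / 8 : ℂ) 1 b} ≤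
        ((Algebra.adjoin ℂ[X] {(1 : ℂ[X]) ⊗ₜ[ℂ] deformedCasimir (1 / 8 : ℂ) 1 b}).restrictScalars
          ℂ).comap Algebra.TensorProduct.includeRight :=
      Algebra.adjoin_le (Set.singleton_subset_iff.2 (Algebra.self_mem_adjoin_singleton _ _))
    have hz : (1 : ℂ[X]) ⊗ₜ[ℂ] (z : UniversalEnvelopingAlgebra ℂ Sl2) ∈
        Algebra.adjoin ℂ[X] {(1 : ℂ[X]) ⊗ₜ[ℂ] deformedCasimir (1 / 8 : ℂ) 1 b} :=
      hle (hcen.le z.2)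
    have hpz := Subalgebra.smul_mem _ hz p
    rwa [TensorProduct.smul_tmul', smul_eq_mul, mul_one] at hpz

theorem envBaseChange_familyCasimir (n : ℕ) (H E F : Sl2) :
    envBaseChange (familyCasimir n (1 ⊗ₜ[ℂ] H : ConstFamily) (1 ⊗ₜ[ℂ] E)
      ((Polynomial.X ^ n : ℂ[X]) ⊗ₜ[ℂ] F)) = (Polynomial.X ^ n : ℂ[X]) ⊗ₜ[ℂ] casimir H E F := by
  rw [familyCasimir, casimir]
  simp only [map_add, map_smul, map_mul, map_pow, envBaseChange_ι, Algebra.TensorProduct.tmul_pow,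
    Algebra.TensorProduct.tmul_mul_tmul, one_pow, mul_one, one_mul, ← TensorProduct.tmul_add]
  rw [TensorProduct.smul_tmul', TensorProduct.smul_tmul',
    TensorProduct.tmul_add _ ((1 / 8 : ℂ) • _), TensorProduct.tmul_smul,
    TensorProduct.tmul_smul, TensorProduct.smul_tmul', TensorProduct.smul_tmul',
    Polynomial.smul_eq_C_mul, Polynomial.smul_eq_C_mul, smul_eq_mul, smul_eq_mul, mul_one]

theorem envInclusion_familyCasimir (n : ℕ) (h e f : subfamily n) :
    envInclusion n (familyCasimir n h e f) =
      familyCasimir n (h : ConstFamily) (e : ConstFamily) (f : ConstFamily) := by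
  rw [familyCasimir, familyCasimir]
  simp only [map_add, map_smul, map_mul, map_pow, envInclusion_ι]

theorem map_center_const {b : Module.Basis (Fin 3) ℂ Sl2} (hb : IsDeformedBasis 1 b) :
    (Subalgebra.center ℂ[X] (UniversalEnvelopingAlgebra ℂ[X] ConstFamily)).map envBaseChange =
      constCenter.range := by
  have h0 := envBaseChange_familyCasimir 0 (b 0) (b 1) (b 2)
  simp only [pow_zero, ← constBasis_apply] at h0
  rw [familyCasimir_eq, pow_zero, casimir_eq] at h0
  rw [constCenter_range hb, center_eq_adjoin_deformedCasimir (isDeformedBasis_constBasis hb)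
    eight_mul_C, AlgHom.map_adjoin_singleton, h0]

/-- The inclusion multiplies the Poincaré–Birkhoff–Witt monomial with `a` factors `Yₙ` by the
nonzero polynomial `xⁿᵃ`. -/
theorem envInclusion_injective {n : ℕ} {b : Module.Basis (Fin 3) ℂ Sl2}
    (hb : IsDeformedBasis 1 b) {bn : Module.Basis (Fin 3) ℂ[X] (subfamily n)}
    (hbn : IsFamilyBasis n bn) (h0 : (bn 0 : ConstFamily) = constBasis b 0)
    (h1 : (bn 1 : ConstFamily) = constBasis b 1)
    (h2 : (bn 2 : ConstFamily) = (Polynomial.X ^ n : ℂ[X]) • constBasis b 2) :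
    Function.Injective (envInclusion n) := by
  refine injective_of_basis_map_smul (pbwBasis hbn.isDeformedBasis)
    (pbwBasis (isDeformedBasis_constBasis hb)) (fun i => (Polynomial.X ^ n) ^ i.1.1)
    (fun i => pow_ne_zero _ (pow_ne_zero _ Polynomial.X_ne_zero)) (envInclusion n).toLinearMap ?_
  intro i
  rw [AlgHom.toLinearMap_apply, pbwBasis_apply, pbwBasis_apply]
  simp only [map_mul, map_pow, envInclusion_ι, h0, h1, h2, map_smul, smul_pow, smul_mul_assoc]

theorem center_family {L : Type*} [LieRing L] [LieAlgebra ℂ[X] L] {n : ℕ}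
    {b : Module.Basis (Fin 3) ℂ[X] L} (hb : IsFamilyBasis n b) :
    Subalgebra.center ℂ[X] (UniversalEnvelopingAlgebra ℂ[X] L) =
        Algebra.adjoin ℂ[X] {familyCasimir n (b 0) (b 1) (b 2)} ∧
      Transcendental ℂ[X] (familyCasimir n (b 0) (b 1) (b 2)) := by
  rw [familyCasimir_eq]
  exact ⟨center_eq_adjoin_deformedCasimir hb.isDeformedBasis eight_mul_C,
    transcendental_deformedCasimir hb.isDeformedBasis (right_ne_zero_of_mul_eq_one eight_mul_C)⟩

/-- A Lie algebra over `ℂ[x]` with a basis of the given shape is unique up to isomorphism. -/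
theorem exists_lieEquiv {L L' : Type*} [LieRing L] [LieAlgebra ℂ[X] L] [LieRing L']
    [LieAlgebra ℂ[X] L'] {n : ℕ} {b : Module.Basis (Fin 3) ℂ[X] L}
    {b' : Module.Basis (Fin 3) ℂ[X] L'} (hb : IsFamilyBasis n b) (hb' : IsFamilyBasis n b') :
    ∃ e : L ≃ₗ⁅ℂ[X]⁆ L', ∀ i, e (b i) = b' i := by
  have he : ∀ i, b.equiv b' (Equiv.refl _) (b i) = b' i := fun i => by simp
  refine ⟨{ b.equiv b' (Equiv.refl _) with
    map_lie' := fun {x y} => map_lie_of_basis b (b.equiv b' (Equiv.refl _)).toLinearMap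
      ?_ ?_ ?_ x y }, he⟩ <;> simp only [LinearEquiv.coe_coe]
  · rw [hb.lie_H_X, map_smul, he, he, hb'.lie_H_X]
  · rw [hb.lie_H_Y, map_smul, he, he, hb'.lie_H_Y]
  · rw [hb.lie_X_Y, map_smul, he, he, he, hb'.lie_X_Y]

end Comparison

end Sl2Family

end

theorem mainTheorem7 (n : ℕ) (H E F : Sl2Family.Sl2)
    (hH : H ∈ Sl2Family.isotypic 0) (hE : E ∈ Sl2Family.isotypic 2)
    (hF : F ∈ Sl2Family.isotypic (-2)) (hHEF : IsSl2Triple H E F) :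
    -- the identification of `ℂ[x] ⊗ 𝒵(𝔤)` with `𝒵(𝔤(0))`
    (Function.Bijective Sl2Family.envBaseChange ∧
      Function.Injective Sl2Family.constCenter ∧
      (Subalgebra.center ℂ[X]
          (UniversalEnvelopingAlgebra ℂ[X] Sl2Family.ConstFamily)).map Sl2Family.envBaseChange =
        Sl2Family.constCenter.range) ∧
    -- the center of `𝒰(𝔩(n))` inside `ℂ[x] ⊗ 𝒵(𝔤)`
    (Function.Injective (Sl2Family.envInclusion n) ∧
      ∃ z : Subalgebra.center ℂ (UniversalEnvelopingAlgebra ℂ Sl2Family.Sl2),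
        (z : UniversalEnvelopingAlgebra ℂ Sl2Family.Sl2) = Sl2Family.casimir H E F ∧
        Sl2Family.envBaseChange (Sl2Family.envInclusion n
            (Sl2Family.familyCasimir n (Sl2Family.elemH n H hH) (Sl2Family.elemX n E hE)
              (Sl2Family.elemY n F))) =
          Sl2Family.constCenter ((Polynomial.X ^ n : ℂ[X]) ⊗ₜ[ℂ] z) ∧
        (Subalgebra.center ℂ[X]
            (UniversalEnvelopingAlgebra ℂ[X] (Sl2Family.subfamily n))).map
            (Sl2Family.envBaseChange.comp (Sl2Family.envInclusion n)) =
          (Algebra.adjoin ℂ[X] {(Polynomial.X ^ n : ℂ[X]) ⊗ₜ[ℂ] z}).map Sl2Family.constCenter) ∧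
    -- the center of `𝒰(𝔩(n))` is the polynomial algebra `ℂ[x][Ωₙ]`
    (Subalgebra.center ℂ[X] (UniversalEnvelopingAlgebra ℂ[X] (Sl2Family.subfamily n)) =
        Algebra.adjoin ℂ[X] {Sl2Family.familyCasimir n (Sl2Family.elemH n H hH)
          (Sl2Family.elemX n E hE) (Sl2Family.elemY n F)} ∧
      Transcendental ℂ[X] (Sl2Family.familyCasimir n (Sl2Family.elemH n H hH)
        (Sl2Family.elemX n E hE) (Sl2Family.elemY n F))) ∧
    -- `Hₙ, Xₙ, Yₙ` is a basis of `𝔩(n)` with the structure constants of `𝔤(n)`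
    (∃ b : Module.Basis (Fin 3) ℂ[X] (Sl2Family.subfamily n),
      Sl2Family.IsFamilyBasis n b ∧ b 0 = Sl2Family.elemH n H hH ∧
        b 1 = Sl2Family.elemX n E hE ∧ b 2 = Sl2Family.elemY n F) ∧
    -- the same description of the center for every realization of `𝔤(n)`
    (∀ (L : Type*) [LieRing L] [LieAlgebra ℂ[X] L] (b : Module.Basis (Fin 3) ℂ[X] L),
      Sl2Family.IsFamilyBasis n b →
      (∃ e : Sl2Family.subfamily n ≃ₗ⁅ℂ[X]⁆ L, e (Sl2Family.elemH n H hH) = b 0 ∧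
        e (Sl2Family.elemX n E hE) = b 1 ∧ e (Sl2Family.elemY n F) = b 2) ∧
      Subalgebra.center ℂ[X] (UniversalEnvelopingAlgebra ℂ[X] L) =
        Algebra.adjoin ℂ[X] {Sl2Family.familyCasimir n (b 0) (b 1) (b 2)} ∧
      Transcendental ℂ[X] (Sl2Family.familyCasimir n (b 0) (b 1) (b 2))) := by
  obtain ⟨b, h0, h1, h2⟩ := Sl2Family.exists_sl2_basis hH hE hF hHEF
  have hb := Sl2Family.isDeformedBasis_sl2 hHEF h0 h1 h2
  obtain ⟨bn, hbn, n0, n1, n2⟩ := Sl2Family.exists_subfamily_basis n hH hE hF hHEF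
  have hcen := Sl2Family.center_family hbn
  rw [n0, n1, n2] at hcen
  have hΩ : Sl2Family.casimir H E F ∈
      Subalgebra.center ℂ (UniversalEnvelopingAlgebra ℂ Sl2Family.Sl2) := by
    rw [← h0, ← h1, ← h2, Sl2Family.casimir_eq]
    exact Sl2Family.deformedCasimir_mem_center hb _
  have hΩn : Sl2Family.envBaseChange (Sl2Family.envInclusion n
      (Sl2Family.familyCasimir n (Sl2Family.elemH n H hH) (Sl2Family.elemX n E hE)
        (Sl2Family.elemY n F))) =
      Sl2Family.constCenter ((Polynomial.X ^ n : ℂ[X]) ⊗ₜ[ℂ] ⟨Sl2Family.casimir H E F, hΩ⟩) := by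
    rw [Sl2Family.envInclusion_familyCasimir]
    exact Sl2Family.envBaseChange_familyCasimir n H E F
  refine ⟨⟨Sl2Family.envBaseChange_bijective hb, Sl2Family.constCenter_injective,
    Sl2Family.map_center_const hb⟩, ⟨?_, ⟨_, hΩ⟩, rfl, hΩn, ?_⟩, hcen, ⟨bn, hbn, n0, n1, n2⟩,
    fun L _ _ b' hb' => ⟨?_, Sl2Family.center_family hb'⟩⟩
  · refine Sl2Family.envInclusion_injective hb hbn ?_ ?_ ?_
    · rw [n0, Sl2Family.constBasis_apply, h0]; rfl
    · rw [n1, Sl2Family.constBasis_apply, h1]; rfl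
    · rw [n2, Sl2Family.constBasis_apply, h2, TensorProduct.smul_tmul', smul_eq_mul, mul_one]; rfl
  · rw [hcen.1, AlgHom.map_adjoin_singleton, AlgHom.map_adjoin_singleton, ← hΩn]; rfl
  · obtain ⟨e, he⟩ := Sl2Family.exists_lieEquiv hbn hb'
    exact ⟨e, n0 ▸ he 0, n1 ▸ he 1, n2 ▸ he 2⟩
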